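/- A Cantor set is a nonempty, compact, perfect, nowhere dense subset of $\mathbb{R}$. For a Cantor set $K$, write $K_+ = K\cap(0,\infty)$ and $K_- = -(K\cap(-\infty,0))$; $K$ is called a $0$-Cantor set if $K_+$ and $K_-$ are nonempty and $\inf K_+ = \inf K_- = 0$. A gap of $K$ is a connected component $U$ of $\mathbb{R}\setminus K$, with left endpoint $U^L$, right endpoint $U^R$ and length $|U|$ (so $K$ has two unbounded gaps, of length $\infty$); write $U_1<U_2$ if $U_1^R<U_2^L$. The thickness of $K$ is $$\tau(K)=\inf_{U_1<U_2}\max\left\{\frac{U_2^L-U_1^R}{|U_1|},\ \frac{U_2^L-U_1^R}{|U_2|}\right\},$$ the infimum being over all pairs of gaps of $K$ at least one of which is bounded, with $t/\infty=0$. Write $K\cdot L=\{xy : x\in K,\ y\in L\}$. Theorem. Let $K, L$ be $0$-Cantor sets. If $$2(\tau(K)+1)(\tau(L)+1)\le(\tau(K)\tau(L)-1)^2,$$ then $K\cdot L$ is a (nondegenerate, closed, bounded) interval. In particular, if $\tau(K)=\tau(L)\ge 1+\sqrt2$, then $K\cdot L$ is an interval. Furthermore, let $M,N>0$ be real numbers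 with $$2(M+1)(N+1)>(MN-1)^2.$$ Then there exist $0$-Cantor sets $K, L$ with $\tau(K)=M$ and $\tau(L)=N$ such that $K\cdot L$ is a disjoint union of two (nondegenerate, closed, bounded) intervals. -/

import Mathlib

open scoped Pointwise

namespace CantorProduct

/-- A Cantor set in the real line: nonempty, compact, perfect and nowhere dense. -/
structure IsCantorSet (K : Set ℝ) : Prop where
  nonempty : K.Nonempty
  compact : IsCompact K
  perfect : Perfect K
  nowhereDense : IsNowhereDense K

/-- A gap of `K`, bounded or unbounded: a connected component of the complement of `K`. -/
def IsGap (K U : Set ℝ) : Prop :=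
  ∃ x ∈ Kᶜ, U = connectedComponentIn Kᶜ x

/-- `U < V` for gaps: the right endpoint of `U` and the left endpoint of `V` are finite,
and the former is smaller than the latter. -/
def GapLT (U V : Set ℝ) : Prop :=
  BddAbove U ∧ BddBelow V ∧ sSup U < sInf V

open Classical in
/-- The quotient `d / |U|` of a real number by the length of a gap; it is `0` when `U` is
unbounded, i.e. when `|U| = ∞`. -/
noncomputable def ratio (d : ℝ) (U : Set ℝ) : ℝ :=
  if Bornology.IsBounded U then d / (sSup U - sInf U) else 0

/-- The thickness of `K`: the infimum of `max ((V^L - U^R) / |U|) ((V^L - U^R) / |V|)` over all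
pairs of gaps `U < V` of `K`, at least one of which is bounded. For a Cantor set this is the
infimum of a nonempty set of nonnegative real numbers. -/
noncomputable def thickness (K : Set ℝ) : ℝ :=
  sInf {r : ℝ | ∃ U V : Set ℝ, IsGap K U ∧ IsGap K V ∧ GapLT U V ∧
    (Bornology.IsBounded U ∨ Bornology.IsBounded V) ∧
    r = max (ratio (sInf V - sSup U) U) (ratio (sInf V - sSup U) V)}

/-- `K₊ = K ∩ (0, ∞)`. -/
def posPart (K : Set ℝ) : Set ℝ := K ∩ Set.Ioi 0

/-- `K₋ = -(K ∩ (-∞, 0))`, a set of positive numbers. -/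
def negPart (K : Set ℝ) : Set ℝ := -(K ∩ Set.Iio 0)

/-- A `0`-Cantor set: a Cantor set that accumulates at `0` from both sides. -/
structure IsZeroCantorSet (K : Set ℝ) : Prop where
  isCantorSet : IsCantorSet K
  posPart_nonempty : (posPart K).Nonempty
  negPart_nonempty : (negPart K).Nonempty
  sInf_posPart : sInf (posPart K) = 0
  sInf_negPart : sInf (negPart K) = 0

end CantorProduct

namespace CantorProduct

/-! ### Gaps through their endpoints, and thickness -/

/-- `(a, b)` is a bounded gap of `K`, described by its endpoints. -/
structure BddGap (K : Set ℝ) (a b : ℝ) : Prop where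
  left_mem : a ∈ K
  right_mem : b ∈ K
  lt : a < b
  le_or_le : ∀ z ∈ K, z ≤ a ∨ b ≤ z

/-- The endpoint form of `M ≤ τ(K)`. For `M > 0` it also says that distinct gaps have no common
endpoint. -/
structure Thick (M : ℝ) (K : Set ℝ) : Prop where
  pair : ∀ a b c d, BddGap K a b → BddGap K c d → b ≤ c → M * min (b - a) (d - c) ≤ c - b
  left : ∀ a b, BddGap K a b → ∃ z ∈ K, M * (b - a) ≤ a - z
  right : ∀ a b, BddGap K a b → ∃ z ∈ K, M * (b - a) ≤ z - b

theorem BddGap.neg {K : Set ℝ} {a b : ℝ} (h : BddGap K a b) : BddGap (-K) (-b) (-a) where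
  left_mem := by simpa using h.right_mem
  right_mem := by simpa using h.left_mem
  lt := by linarith [h.lt]
  le_or_le z hz := by
    rcases h.le_or_le (-z) hz with h | h
    · right; linarith
    · left; linarith

theorem bddGap_neg_iff {K : Set ℝ} {a b : ℝ} : BddGap (-K) a b ↔ BddGap K (-b) (-a) :=
  ⟨fun h => by simpa using h.neg, fun h => by simpa using h.neg⟩

theorem Thick.neg {M : ℝ} {K : Set ℝ} (h : Thick M K) : Thick M (-K) where
  pair a b c d hab hcd hbc := by
    have := h.pair _ _ _ _ (bddGap_neg_iff.1 hcd) (bddGap_neg_iff.1 hab) (by linarith)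
    rw [min_comm]
    convert this using 1 <;> ring_nf
  left a b hab := by
    obtain ⟨z, hz, h1⟩ := h.right _ _ (bddGap_neg_iff.1 hab)
    exact ⟨-z, by simpa using hz, by linarith⟩
  right a b hab := by
    obtain ⟨z, hz, h1⟩ := h.left _ _ (bddGap_neg_iff.1 hab)
    exact ⟨-z, by simpa using hz, by linarith⟩

theorem connectedComponentIn_compl_eq {K I : Set ℝ} {x : ℝ} (hx : x ∈ I) (hI : I.OrdConnected)
    (hIK : I ⊆ Kᶜ) (hout : ∀ y, y ∉ I → ∃ z ∈ K, z ∈ Set.uIcc x y) :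
    connectedComponentIn Kᶜ x = I := by
  apply Set.Subset.antisymm
  · intro y hy
    by_contra hyI
    obtain ⟨z, hzK, hz⟩ := hout y hyI
    have hoc : (connectedComponentIn Kᶜ x).OrdConnected :=
      isPreconnected_connectedComponentIn.ordConnected
    exact connectedComponentIn_subset _ _
      (hoc.uIcc_subset (mem_connectedComponentIn (hIK hx)) hy hz) hzK
  · exact hI.isPreconnected.subset_connectedComponentIn hx hIK

theorem BddGap.component {K : Set ℝ} {a b x : ℝ} (h : BddGap K a b) (hx : x ∈ Set.Ioo a b) :
    connectedComponentIn Kᶜ x = Set.Ioo a b := by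
  refine connectedComponentIn_compl_eq hx Set.ordConnected_Ioo ?_ ?_
  · intro z hz hzK
    rcases h.le_or_le z hzK with h1 | h1
    · exact absurd hz.1 (not_lt.2 h1)
    · exact absurd hz.2 (not_lt.2 h1)
  · intro y hy
    rcases le_or_gt y a with h1 | h1
    · exact ⟨a, h.left_mem, Set.mem_uIcc.2 (Or.inr ⟨h1, hx.1.le⟩)⟩
    · exact ⟨b, h.right_mem, Set.mem_uIcc.2 (Or.inl ⟨hx.2.le, by
        by_contra h2; exact hy ⟨h1, not_le.1 h2⟩⟩)⟩

theorem BddGap.isGap {K : Set ℝ} {a b : ℝ} (h : BddGap K a b) : IsGap K (Set.Ioo a b) := by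
  obtain ⟨x, hx⟩ := Set.nonempty_Ioo.2 h.lt
  refine ⟨x, fun hxK => ?_, (h.component hx).symm⟩
  rcases h.le_or_le x hxK with h1 | h1
  · exact absurd hx.1 (not_lt.2 h1)
  · exact absurd hx.2 (not_lt.2 h1)

theorem component_Ioi {K : Set ℝ} {k x : ℝ} (hk : IsGreatest K k) (hx : k < x) :
    connectedComponentIn Kᶜ x = Set.Ioi k :=
  connectedComponentIn_compl_eq hx Set.ordConnected_Ioi
    (fun _ hz hzK => absurd (hk.2 hzK) (not_le.2 hz))
    (fun _ hy => ⟨k, hk.1, Set.mem_uIcc.2 (Or.inr ⟨not_lt.1 hy, hx.le⟩)⟩)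

theorem component_Iio {K : Set ℝ} {k x : ℝ} (hk : IsLeast K k) (hx : x < k) :
    connectedComponentIn Kᶜ x = Set.Iio k :=
  connectedComponentIn_compl_eq hx Set.ordConnected_Iio
    (fun _ hz hzK => absurd (hk.2 hzK) (not_le.2 hz))
    (fun _ hy => ⟨k, hk.1, Set.mem_uIcc.2 (Or.inl ⟨hx.le, not_lt.1 hy⟩)⟩)

theorem isGap_Ioi {K : Set ℝ} {k : ℝ} (hk : IsGreatest K k) : IsGap K (Set.Ioi k) :=
  ⟨k + 1, fun h => by linarith [hk.2 h], (component_Ioi hk (by linarith)).symm⟩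

theorem isGap_Iio {K : Set ℝ} {k : ℝ} (hk : IsLeast K k) : IsGap K (Set.Iio k) :=
  ⟨k - 1, fun h => by linarith [hk.2 h], (component_Iio hk (by linarith)).symm⟩

theorem exists_isGreatest_inter_Iic {K : Set ℝ} (hK : IsCompact K) {x y : ℝ} (hy : y ∈ K)
    (hyx : y ≤ x) : ∃ a, IsGreatest (K ∩ Set.Iic x) a :=
  (hK.inter_right isClosed_Iic).exists_isGreatest ⟨y, hy, hyx⟩

theorem exists_isLeast_inter_Ici {K : Set ℝ} (hK : IsCompact K) {x y : ℝ} (hy : y ∈ K)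
    (hyx : x ≤ y) : ∃ a, IsLeast (K ∩ Set.Ici x) a :=
  (hK.inter_right isClosed_Ici).exists_isLeast ⟨y, hy, hyx⟩

/-- A point outside `K` which lies between two points of `K` is in a bounded gap. -/
theorem exists_bddGap {K : Set ℝ} (hK : IsCompact K) {x y z : ℝ} (hx : x ∉ K) (hy : y ∈ K)
    (hz : z ∈ K) (hyx : y ≤ x) (hxz : x ≤ z) : ∃ a b, BddGap K a b ∧ x ∈ Set.Ioo a b := by
  obtain ⟨a, ha⟩ := exists_isGreatest_inter_Iic hK hy hyx
  obtain ⟨b, hb⟩ := exists_isLeast_inter_Ici hK hz hxz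
  have hax : a < x := lt_of_le_of_ne ha.1.2 fun h => hx (h ▸ ha.1.1)
  have hxb : x < b := lt_of_le_of_ne hb.1.2 fun h => hx (h ▸ hb.1.1)
  refine ⟨a, b, ⟨ha.1.1, hb.1.1, hax.trans hxb, fun w hw => ?_⟩, hax, hxb⟩
  rcases le_total w x with h | h
  · exact Or.inl (ha.2 ⟨hw, h⟩)
  · exact Or.inr (hb.2 ⟨hw, h⟩)

theorem IsGap.cases {K U : Set ℝ} (hK : IsCompact K) {k l : ℝ} (hk : IsLeast K k)
    (hl : IsGreatest K l) (hU : IsGap K U) :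
    (∃ a b, BddGap K a b ∧ U = Set.Ioo a b) ∨ U = Set.Iio k ∨ U = Set.Ioi l := by
  obtain ⟨x, hx, rfl⟩ := hU
  rcases lt_or_ge x k with h | h
  · exact Or.inr (Or.inl (component_Iio hk h))
  rcases lt_or_ge l x with h' | h'
  · exact Or.inr (Or.inr (component_Ioi hl h'))
  · obtain ⟨a, b, hab, hx'⟩ := exists_bddGap hK hx hk.1 hl.1 h h'
    exact Or.inl ⟨a, b, hab, hab.component hx'⟩

theorem ratio_Ioo (d : ℝ) {a b : ℝ} (h : a < b) : ratio d (Set.Ioo a b) = d / (b - a) := by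
  rw [ratio, if_pos (Metric.isBounded_Ioo a b), csSup_Ioo h, csInf_Ioo h]

theorem not_isBounded_Ioi (a : ℝ) : ¬ Bornology.IsBounded (Set.Ioi a) :=
  fun h => not_bddAbove_Ioi a h.bddAbove

theorem not_isBounded_Iio (a : ℝ) : ¬ Bornology.IsBounded (Set.Iio a) :=
  fun h => not_bddBelow_Iio a h.bddBelow

theorem ratio_Ioi (d a : ℝ) : ratio d (Set.Ioi a) = 0 := if_neg (not_isBounded_Ioi a)

theorem ratio_Iio (d a : ℝ) : ratio d (Set.Iio a) = 0 := if_neg (not_isBounded_Iio a)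

/-- The set whose infimum is the thickness. -/
def thicknessSet (K : Set ℝ) : Set ℝ :=
  {r : ℝ | ∃ U V : Set ℝ, IsGap K U ∧ IsGap K V ∧ GapLT U V ∧
    (Bornology.IsBounded U ∨ Bornology.IsBounded V) ∧
    r = max (ratio (sInf V - sSup U) U) (ratio (sInf V - sSup U) V)}

theorem mem_thicknessSet_pair {K : Set ℝ} {a b c d : ℝ} (h : BddGap K a b) (h' : BddGap K c d)
    (hbc : b < c) : max ((c - b) / (b - a)) ((c - b) / (d - c)) ∈ thicknessSet K := by
  refine ⟨_, _, h.isGap, h'.isGap, ⟨bddAbove_Ioo, bddBelow_Ioo, ?_⟩,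
    Or.inl (Metric.isBounded_Ioo a b), ?_⟩
  · rwa [csSup_Ioo h.lt, csInf_Ioo h'.lt]
  · rw [csSup_Ioo h.lt, csInf_Ioo h'.lt, ratio_Ioo _ h.lt, ratio_Ioo _ h'.lt]

theorem mem_thicknessSet_right {K : Set ℝ} {a b l : ℝ} (h : BddGap K a b) (hl : IsGreatest K l)
    (hbl : b < l) : (l - b) / (b - a) ∈ thicknessSet K := by
  refine ⟨_, _, h.isGap, isGap_Ioi hl, ⟨bddAbove_Ioo, bddBelow_Ioi, ?_⟩,
    Or.inl (Metric.isBounded_Ioo a b), ?_⟩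
  · rwa [csSup_Ioo h.lt, csInf_Ioi]
  · rw [csSup_Ioo h.lt, csInf_Ioi, ratio_Ioo _ h.lt, ratio_Ioi, max_eq_left]
    exact div_nonneg (by linarith) (by linarith [h.lt])

theorem mem_thicknessSet_left {K : Set ℝ} {a b k : ℝ} (h : BddGap K a b) (hk : IsLeast K k)
    (hka : k < a) : (a - k) / (b - a) ∈ thicknessSet K := by
  refine ⟨_, _, isGap_Iio hk, h.isGap, ⟨bddAbove_Iio, bddBelow_Ioo, ?_⟩,
    Or.inr (Metric.isBounded_Ioo a b), ?_⟩
  · rwa [csInf_Ioo h.lt, csSup_Iio]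
  · rw [csInf_Ioo h.lt, csSup_Iio, ratio_Ioo _ h.lt, ratio_Iio, max_eq_right]
    exact div_nonneg (by linarith) (by linarith [h.lt])

theorem thicknessSet_nonneg {K : Set ℝ} {r : ℝ} (hr : r ∈ thicknessSet K) : 0 ≤ r := by
  obtain ⟨U, V, -, -, ⟨hU, hV, hUV⟩, hb, rfl⟩ := hr
  rcases hb with hb | hb
  · refine le_max_of_le_left ?_
    rw [ratio, if_pos hb]
    exact div_nonneg (by linarith) (by linarith [Real.sInf_le_sSup U hb.bddBelow hb.bddAbove])
  · refine le_max_of_le_right ?_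
    rw [ratio, if_pos hb]
    exact div_nonneg (by linarith) (by linarith [Real.sInf_le_sSup V hb.bddBelow hb.bddAbove])

theorem thickness_le {K : Set ℝ} {r : ℝ} (hr : r ∈ thicknessSet K) : thickness K ≤ r :=
  csInf_le ⟨0, fun _ h => thicknessSet_nonneg h⟩ hr

theorem thickness_nonneg (K : Set ℝ) : 0 ≤ thickness K :=
  Real.sInf_nonneg fun _ h => thicknessSet_nonneg h

theorem mul_min_le_of_le_max_div {M d u v : ℝ} (hu : 0 < u) (hv : 0 < v) (hd : 0 ≤ d)
    (hM : M ≤ max (d / u) (d / v)) : M * min u v ≤ d := by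
  have hm : 0 < min u v := lt_min hu hv
  rw [← le_div_iff₀ hm]
  refine hM.trans (max_le ?_ ?_)
  · exact div_le_div_of_nonneg_left hd hm (min_le_left _ _)
  · exact div_le_div_of_nonneg_left hd hm (min_le_right _ _)

theorem le_max_div_of_mul_min_le {M d u v : ℝ} (hu : 0 < u) (hv : 0 < v)
    (hM : M * min u v ≤ d) : M ≤ max (d / u) (d / v) := by
  rcases le_total u v with h | h
  · rw [min_eq_left h] at hM
    exact le_max_of_le_left ((le_div_iff₀ hu).2 hM)
  · rw [min_eq_right h] at hM
    exact le_max_of_le_right ((le_div_iff₀ hv).2 hM)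

theorem Thick.le_thickness {M : ℝ} {K : Set ℝ} (hM : 0 < M) (hK : IsCompact K)
    (h : Thick M K) {a b : ℝ} (hab : BddGap K a b) : M ≤ thickness K := by
  obtain ⟨k, hk⟩ := hK.exists_isLeast ⟨a, hab.left_mem⟩
  obtain ⟨l, hl⟩ := hK.exists_isGreatest ⟨a, hab.left_mem⟩
  have hright : ∀ a b, BddGap K a b → M * (b - a) ≤ l - b := fun a b hab => by
    obtain ⟨z, hz, h1⟩ := h.right a b hab
    linarith [hl.2 hz]
  have hleft : ∀ a b, BddGap K a b → M * (b - a) ≤ a - k := fun a b hab => by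
    obtain ⟨z, hz, h1⟩ := h.left a b hab
    linarith [hk.2 hz]
  -- The infimum of the empty set is `0`, so a bounded gap is needed for a positive lower bound.
  have hne : (thicknessSet K).Nonempty := by
    have := mul_pos hM (sub_pos.2 hab.lt)
    exact ⟨_, mem_thicknessSet_right hab hl (by linarith [hright a b hab])⟩
  refine le_csInf hne ?_
  rintro r ⟨U, V, hU, hV, ⟨hbU, hbV, hUV⟩, hb, rfl⟩
  rcases hU.cases hK hk hl with ⟨a, b, hab, rfl⟩ | rfl | rfl
  · rcases hV.cases hK hk hl with ⟨c, d, hcd, rfl⟩ | rfl | rfl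
    · rw [csSup_Ioo hab.lt, csInf_Ioo hcd.lt] at hUV ⊢
      rw [ratio_Ioo _ hab.lt, ratio_Ioo _ hcd.lt]
      exact le_max_div_of_mul_min_le (sub_pos.2 hab.lt) (sub_pos.2 hcd.lt)
        (h.pair _ _ _ _ hab hcd hUV.le)
    · exact absurd hbV (not_bddBelow_Iio _)
    · rw [csSup_Ioo hab.lt, csInf_Ioi, ratio_Ioo _ hab.lt]
      exact le_max_of_le_left ((le_div_iff₀ (sub_pos.2 hab.lt)).2 (hright _ _ hab))
  · rcases hV.cases hK hk hl with ⟨c, d, hcd, rfl⟩ | rfl | rfl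
    · rw [csSup_Iio, csInf_Ioo hcd.lt, ratio_Ioo _ hcd.lt]
      exact le_max_of_le_right ((le_div_iff₀ (sub_pos.2 hcd.lt)).2 (hleft _ _ hcd))
    · exact absurd hbV (not_bddBelow_Iio _)
    · exact absurd hb (not_or.2 ⟨not_isBounded_Iio _, not_isBounded_Ioi _⟩)
  · exact absurd hbU (not_bddAbove_Ioi _)

theorem isCantorSet_iff {K : Set ℝ} : IsCantorSet K ↔ K.Nonempty ∧ IsCompact K ∧
    interior K = ∅ ∧ ∀ x ∈ K, ∀ ε > 0, ∃ y ∈ K, y ≠ x ∧ |y - x| < ε := by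
  constructor
  · rintro ⟨h1, h2, h3, h4⟩
    refine ⟨h1, h2, ?_, fun x hx ε hε => ?_⟩
    · rwa [IsNowhereDense, h2.isClosed.closure_eq] at h4
    · obtain ⟨y, ⟨hy1, hy2⟩, hy3⟩ :=
        preperfect_iff_nhds.1 h3.acc x hx _ (Metric.ball_mem_nhds x hε)
      exact ⟨y, hy2, hy3, hy1⟩
  · rintro ⟨h1, h2, h3, h4⟩
    refine ⟨h1, h2, ⟨h2.isClosed, preperfect_iff_nhds.2 fun x hx U hU => ?_⟩, ?_⟩
    · obtain ⟨ε, hε, hU⟩ := Metric.mem_nhds_iff.1 hU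
      obtain ⟨y, hy, hyx, hd⟩ := h4 x hx ε hε
      exact ⟨y, ⟨hU hd, hy⟩, hyx⟩
    · rwa [IsNowhereDense, h2.isClosed.closure_eq]

theorem IsCantorSet.not_bddGap_of_bddGap {K : Set ℝ} (hK : IsCantorSet K) {a b c : ℝ}
    (h : BddGap K a b) : ¬ BddGap K b c := fun h' => by
  obtain ⟨y, hy, hyb, hd⟩ := (isCantorSet_iff.1 hK).2.2.2 b h.right_mem (min (b - a) (c - b))
    (lt_min (sub_pos.2 h.lt) (sub_pos.2 h'.lt))
  rw [lt_min_iff, abs_lt, abs_lt] at hd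
  rcases h.le_or_le y hy with h1 | h1
  · linarith
  · rcases h'.le_or_le y hy with h2 | h2
    · exact hyb (le_antisymm h2 h1)
    · linarith

theorem IsCantorSet.thick {K : Set ℝ} (hK : IsCantorSet K) : Thick (thickness K) K := by
  obtain ⟨k, hk⟩ := hK.compact.exists_isLeast hK.nonempty
  obtain ⟨l, hl⟩ := hK.compact.exists_isGreatest hK.nonempty
  refine ⟨fun a b c d hab hcd hbc => ?_, fun a b hab => ⟨k, hk.1, ?_⟩,
    fun a b hab => ⟨l, hl.1, ?_⟩⟩
  -- Thickness only compares gaps with `b < c`; a common endpoint would be an isolated point of `K`.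
  · have hlt : b < c := lt_of_le_of_ne hbc fun h =>
      hK.not_bddGap_of_bddGap hab (h ▸ hcd)
    exact mul_min_le_of_le_max_div (sub_pos.2 hab.lt) (sub_pos.2 hcd.lt) (by linarith)
      (thickness_le (mem_thicknessSet_pair hab hcd hlt))
  · have hka : k < a := lt_of_le_of_ne (hk.2 hab.left_mem) fun h => by
      obtain ⟨y, hy, hyb, hd⟩ := (isCantorSet_iff.1 hK).2.2.2 a hab.left_mem (b - a)
        (sub_pos.2 hab.lt)
      rw [abs_lt] at hd
      rcases hab.le_or_le y hy with h1 | h1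
      · exact hyb (le_antisymm h1 (h ▸ hk.2 hy))
      · linarith
    exact (le_div_iff₀ (sub_pos.2 hab.lt)).1 (thickness_le (mem_thicknessSet_left hab hk hka))
  · have hbl : b < l := lt_of_le_of_ne (hl.2 hab.right_mem) fun h => by
      obtain ⟨y, hy, hyb, hd⟩ := (isCantorSet_iff.1 hK).2.2.2 b hab.right_mem (b - a)
        (sub_pos.2 hab.lt)
      rw [abs_lt] at hd
      rcases hab.le_or_le y hy with h1 | h1
      · linarith
      · exact hyb (le_antisymm (h ▸ hl.2 hy) h1)
    exact (le_div_iff₀ (sub_pos.2 hab.lt)).1 (thickness_le (mem_thicknessSet_right hab hl hbl))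

/-! ### Linked pairs of gaps -/

/-- The gaps `(a, b)` of `K` and `(t / q, t / p)` of `t / L` are linked, with the former on the
left. -/
structure LinkedLeft (K L : Set ℝ) (t a b p q : ℝ) : Prop where
  gapK : BddGap K a b
  gapL : BddGap L p q
  a_nonneg : 0 ≤ a
  p_nonneg : 0 ≤ p
  aq_lt : a * q < t
  bp_lt : b * p < t
  lt_bq : t < b * q

/-- The gaps `(a, b)` of `K` and `(t / q, t / p)` of `t / L` are linked, with the former on the
right. -/
structure LinkedRight (K L : Set ℝ) (t a b p q : ℝ) : Prop where
  gapK : BddGap K a b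
  gapL : BddGap L p q
  a_nonneg : 0 ≤ a
  p_nonneg : 0 ≤ p
  ap_lt : a * p < t
  lt_aq : t < a * q
  lt_bp : t < b * p

def Linked (K L : Set ℝ) (t a b p q : ℝ) : Prop :=
  LinkedLeft K L t a b p q ∨ LinkedRight K L t a b p q

theorem LinkedLeft.swap {K L : Set ℝ} {t a b p q : ℝ} (h : LinkedLeft K L t a b p q) :
    LinkedLeft L K t p q a b :=
  ⟨h.gapL, h.gapK, h.p_nonneg, h.a_nonneg, by linarith [h.bp_lt], by linarith [h.aq_lt],
    by linarith [h.lt_bq]⟩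

theorem LinkedRight.swap {K L : Set ℝ} {t a b p q : ℝ} (h : LinkedRight K L t a b p q) :
    LinkedRight L K t p q a b :=
  ⟨h.gapL, h.gapK, h.p_nonneg, h.a_nonneg, by linarith [h.ap_lt], by linarith [h.lt_bp],
    by linarith [h.lt_aq]⟩

theorem Linked.swap {K L : Set ℝ} {t a b p q : ℝ} (h : Linked K L t a b p q) :
    Linked L K t p q a b :=
  h.imp LinkedLeft.swap LinkedRight.swap

/-- The compact set of linked pairs of gaps. -/
def linkedSet (K L : Set ℝ) (t : ℝ) : Set (ℝ × ℝ × ℝ × ℝ) :=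
  (K ×ˢ K ×ˢ L ×ˢ L) ∩ {v | 0 ≤ v.1 ∧ v.1 ≤ v.2.1 ∧ 0 ≤ v.2.2.1 ∧ v.2.2.1 ≤ v.2.2.2 ∧
    (∀ z ∈ K, z ≤ v.1 ∨ v.2.1 ≤ z) ∧ (∀ z ∈ L, z ≤ v.2.2.1 ∨ v.2.2.2 ≤ z) ∧
    v.1 * v.2.2.1 ≤ t ∧ t ≤ v.2.1 * v.2.2.2 ∧
    ((v.1 * v.2.2.2 ≤ t ∧ v.2.1 * v.2.2.1 ≤ t) ∨ (t ≤ v.1 * v.2.2.2 ∧ t ≤ v.2.1 * v.2.2.1))}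

theorem isCompact_linkedSet {K L : Set ℝ} (hK : IsCompact K) (hL : IsCompact L) (t : ℝ) :
    IsCompact (linkedSet K L t) := by
  refine (hK.prod (hK.prod (hL.prod hL))).inter_right ?_
  simp only [Set.ofPred_and, Set.ofPred_or, Set.ofPred_forall]
  refine .inter ?_ <| .inter ?_ <| .inter ?_ <| .inter ?_ <| .inter ?_ <| .inter ?_ <|
    .inter ?_ <| .inter ?_ <| .union (.inter ?_ ?_) (.inter ?_ ?_)
  · exact isClosed_le (by fun_prop) (by fun_prop)
  · exact isClosed_le (by fun_prop) (by fun_prop)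
  · exact isClosed_le (by fun_prop) (by fun_prop)
  · exact isClosed_le (by fun_prop) (by fun_prop)
  · exact isClosed_iInter fun z => isClosed_iInter fun _ =>
      .union (isClosed_le (by fun_prop) (by fun_prop)) (isClosed_le (by fun_prop) (by fun_prop))
  · exact isClosed_iInter fun z => isClosed_iInter fun _ =>
      .union (isClosed_le (by fun_prop) (by fun_prop)) (isClosed_le (by fun_prop) (by fun_prop))
  all_goals exact isClosed_le (by fun_prop) (by fun_prop)

/-- The closed inequalities become strict because no product of endpoints equals `t`; the same fact
excludes the degenerate gaps `a = b` and `p = q`. -/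
theorem mem_linkedSet {K L : Set ℝ} {t a b p q : ℝ} (ht : ∀ x ∈ K, ∀ y ∈ L, x * y ≠ t) :
    (a, b, p, q) ∈ linkedSet K L t ↔ Linked K L t a b p q := by
  constructor
  · rintro ⟨⟨ha, hb, hp, hq⟩, h1, h2, h3, h4, h5, h6, h7, h8, h9⟩
    dsimp only at *
    have n1 := ht a ha p hp
    have n2 := ht a ha q hq
    have n3 := ht b hb p hp
    have n4 := ht b hb q hq
    have hab : a < b := lt_of_le_of_ne h2 fun h => by
      subst h
      rcases h9 with ⟨h9, -⟩ | ⟨-, h9⟩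
      · exact n2 (le_antisymm h9 h8)
      · exact n1 (le_antisymm h7 h9)
    have hpq : p < q := lt_of_le_of_ne h4 fun h => by
      subst h
      rcases h9 with ⟨-, h9⟩ | ⟨h9, -⟩
      · exact n3 (le_antisymm h9 h8)
      · exact n1 (le_antisymm h7 h9)
    rcases h9 with ⟨h9, h10⟩ | ⟨h9, h10⟩
    · exact Or.inl ⟨⟨ha, hb, hab, h5⟩, ⟨hp, hq, hpq, h6⟩, h1, h3, lt_of_le_of_ne h9 n2,
        lt_of_le_of_ne h10 n3, lt_of_le_of_ne h8 (Ne.symm n4)⟩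
    · exact Or.inr ⟨⟨ha, hb, hab, h5⟩, ⟨hp, hq, hpq, h6⟩, h1, h3, lt_of_le_of_ne h7 n1,
        lt_of_le_of_ne h9 (Ne.symm n2), lt_of_le_of_ne h10 (Ne.symm n3)⟩
  · rintro (h | h)
    · have hK := h.gapK
      have hL := h.gapL
      refine ⟨⟨hK.left_mem, hK.right_mem, hL.left_mem, hL.right_mem⟩, h.a_nonneg, hK.lt.le,
        h.p_nonneg, hL.lt.le, hK.le_or_le, hL.le_or_le, ?_, h.lt_bq.le,
        Or.inl ⟨h.aq_lt.le, h.bp_lt.le⟩⟩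
      exact (mul_le_mul_of_nonneg_left hL.lt.le h.a_nonneg).trans h.aq_lt.le
    · have hK := h.gapK
      have hL := h.gapL
      refine ⟨⟨hK.left_mem, hK.right_mem, hL.left_mem, hL.right_mem⟩, h.a_nonneg, hK.lt.le,
        h.p_nonneg, hL.lt.le, hK.le_or_le, hL.le_or_le, h.ap_lt.le, ?_,
        Or.inr ⟨h.lt_aq.le, h.lt_bp.le⟩⟩
      have := mul_le_mul_of_nonneg_right hK.lt.le (h.p_nonneg.trans hL.lt.le)
      exact h.lt_aq.le.trans this

/-- Greedy choice: `b` is the first point of `K` from `t / y` on, `q` the first point of `L` from `t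
/ b` on; `a` and `p` are the last points up to `t / q` and `t / b`. Since `q ≤ y`, no point of `K`
lies strictly between `a` and `b`. -/
theorem exists_linkedLeft {K L : Set ℝ} (hK : IsCompact K) (hL : IsCompact L) (hK0 : (0 : ℝ) ∈ K)
    (hL0 : (0 : ℝ) ∈ L) {t x y : ℝ} (ht0 : 0 < t) (ht : ∀ x ∈ K, ∀ y ∈ L, x * y ≠ t)
    (hx : x ∈ K) (hy : y ∈ L) (hy0 : 0 < y) (hxy : t < x * y) :
    ∃ a b p q, LinkedLeft K L t a b p q ∧ b ≤ x ∧ q ≤ y := by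
  obtain ⟨b, ⟨hbK, hb⟩, hb'⟩ := exists_isLeast_inter_Ici (x := t / y) hK hx
    ((div_le_iff₀ hy0).2 hxy.le)
  have hb0 : 0 < b := (div_pos ht0 hy0).trans_le hb
  obtain ⟨q, ⟨hqL, hq⟩, hq'⟩ := exists_isLeast_inter_Ici (x := t / b) hL hy
    ((div_le_iff₀ hb0).2 (by rw [mul_comm]; exact (div_le_iff₀ hy0).1 hb))
  have hq0 : 0 < q := (div_pos ht0 hb0).trans_le hq
  have hbx : b ≤ x := hb' ⟨hx, (div_le_iff₀ hy0).2 hxy.le⟩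
  have hqy : q ≤ y := hq' ⟨hy, (div_le_iff₀ hb0).2
    (by rw [mul_comm]; exact (div_le_iff₀ hy0).1 hb)⟩
  obtain ⟨a, ⟨haK, ha⟩, ha'⟩ := exists_isGreatest_inter_Iic (x := t / q) hK hK0
    (div_pos ht0 hq0).le
  obtain ⟨p, ⟨hpL, hp⟩, hp'⟩ := exists_isGreatest_inter_Iic (x := t / b) hL hL0
    (div_pos ht0 hb0).le
  have ha0 : 0 ≤ a := ha' ⟨hK0, (div_pos ht0 hq0).le⟩
  have hp0 : 0 ≤ p := hp' ⟨hL0, (div_pos ht0 hb0).le⟩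
  have e1 : t < b * q := lt_of_le_of_ne (by rw [mul_comm]; exact (div_le_iff₀ hb0).1 hq)
    (ht b hbK q hqL).symm
  have e2 : a * q < t := lt_of_le_of_ne ((le_div_iff₀ hq0).1 ha) (ht a haK q hqL)
  have e3 : b * p < t := lt_of_le_of_ne
    (by rw [mul_comm]; exact (le_div_iff₀ hb0).1 hp) (ht b hbK p hpL)
  have hab : a < b := lt_of_mul_lt_mul_right (e2.trans e1) hq0.le
  have hpq : p < q := lt_of_mul_lt_mul_left (e3.trans e1) hb0.le
  refine ⟨a, b, p, q, ⟨⟨haK, hbK, hab, fun z hz => ?_⟩, ⟨hpL, hqL, hpq, fun z hz => ?_⟩, ha0, hp0,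
    e2, e3, e1⟩, hbx, hqy⟩
  · rcases le_total z (t / q) with h | h
    · exact Or.inl (ha' ⟨hz, h⟩)
    · exact Or.inr (hb' ⟨hz, (div_le_div_of_nonneg_left ht0.le hq0 hqy).trans h⟩)
  · rcases le_total z (t / b) with h | h
    · exact Or.inl (hp' ⟨hz, h⟩)
    · exact Or.inr (hq' ⟨hz, h⟩)

/-- The mirror image of `exists_linkedLeft`; `x'` and `y'` only ensure that right endpoints `b` and
`q` exist. -/
theorem exists_linkedRight {K L : Set ℝ} (hK : IsCompact K) (hL : IsCompact L) {t x y x' y' : ℝ}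
    (ht : ∀ x ∈ K, ∀ y ∈ L, x * y ≠ t)
    (hx : x ∈ K) (hy : y ∈ L) (hx0 : 0 < x) (hy0 : 0 < y) (hxy : x * y < t)
    (hx' : x' ∈ K) (hy' : y' ∈ L) (hxy' : t ≤ x * y') (hx'y : t ≤ x' * y) :
    ∃ a b p q, LinkedRight K L t a b p q ∧ x ≤ a ∧ y ≤ p := by
  have ht0 : 0 < t := (mul_pos hx0 hy0).trans hxy
  obtain ⟨a, ⟨haK, ha⟩, ha'⟩ := exists_isGreatest_inter_Iic (x := t / y) hK hx
    ((le_div_iff₀ hy0).2 hxy.le)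
  have hxa : x ≤ a := ha' ⟨hx, (le_div_iff₀ hy0).2 hxy.le⟩
  have ha0 : 0 < a := hx0.trans_le hxa
  have hya : y ≤ t / a := (le_div_iff₀ ha0).2 (by rw [mul_comm]; exact (le_div_iff₀ hy0).1 ha)
  obtain ⟨p, ⟨hpL, hp⟩, hp'⟩ := exists_isGreatest_inter_Iic (x := t / a) hL hy hya
  have hyp : y ≤ p := hp' ⟨hy, hya⟩
  have hp0 : 0 < p := hy0.trans_le hyp
  obtain ⟨b, ⟨hbK, hb⟩, hb'⟩ := exists_isLeast_inter_Ici (x := t / p) hK hx'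
    ((div_le_div_of_nonneg_left ht0.le hy0 hyp).trans ((div_le_iff₀ hy0).2 hx'y))
  obtain ⟨q, ⟨hqL, hq⟩, hq'⟩ := exists_isLeast_inter_Ici (x := t / a) hL hy'
    ((div_le_div_of_nonneg_left ht0.le hx0 hxa).trans
      ((div_le_iff₀ hx0).2 (by rwa [mul_comm])))
  have e1 : a * p < t := lt_of_le_of_ne (by rw [mul_comm]; exact (le_div_iff₀ ha0).1 hp)
    (ht a haK p hpL)
  have e2 : t < a * q := lt_of_le_of_ne (by rw [mul_comm]; exact (div_le_iff₀ ha0).1 hq)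
    (ht a haK q hqL).symm
  have e3 : t < b * p := lt_of_le_of_ne ((div_le_iff₀ hp0).1 hb) (ht b hbK p hpL).symm
  have hab : a < b := lt_of_mul_lt_mul_right (e1.trans e3) hp0.le
  have hpq : p < q := lt_of_mul_lt_mul_left (e1.trans e2) ha0.le
  refine ⟨a, b, p, q, ⟨⟨haK, hbK, hab, fun z hz => ?_⟩, ⟨hpL, hqL, hpq, fun z hz => ?_⟩, ha0.le,
    hp0.le, e1, e2, e3⟩, hxa, hyp⟩
  · rcases le_total z (t / p) with h | h
    · exact Or.inl (ha' ⟨hz, h.trans (div_le_div_of_nonneg_left ht0.le hy0 hyp)⟩)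
    · exact Or.inr (hb' ⟨hz, h⟩)
  · rcases le_total z (t / a) with h | h
    · exact Or.inl (hp' ⟨hz, h⟩)
    · exact Or.inr (hq' ⟨hz, h⟩)

/-! ### Consequences of minimality -/

/-- The gaps of `K` that begin to the right of `(a, b)`, at distance less than `M * (b - a)`, are
smaller than `(a, b)`. -/
theorem Thick.sub_lt_right {M : ℝ} {K : Set ℝ} (h : Thick M K) {a b c d : ℝ}
    (hab : BddGap K a b) (hcd : BddGap K c d) (hbc : b ≤ c) (hc : c < b + M * (b - a)) :
    d - c < b - a := by
  by_contra! hle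
  have := h.pair _ _ _ _ hab hcd hbc
  rw [min_eq_left hle] at this
  linarith

theorem Thick.sub_lt_left {M : ℝ} {K : Set ℝ} (h : Thick M K) {a b c d : ℝ}
    (hab : BddGap K a b) (hcd : BddGap K c d) (hda : d ≤ a) (hd : a - M * (b - a) < d) :
    d - c < b - a := by
  by_contra! hle
  have := h.pair _ _ _ _ hcd hab hda
  rw [min_eq_right hle] at this
  linarith

/-- No linked pair, on either side of `0`, is smaller than `w`. -/
def MinLinked (K L : Set ℝ) (t w : ℝ) : Prop :=
  ∀ a b p q, Linked K L t a b p q ∨ Linked (-K) (-L) t a b p q → w ≤ (b - a) + (q - p)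

theorem MinLinked.swap {K L : Set ℝ} {t w w' : ℝ} (h : MinLinked K L t w) (hw : w = w') :
    MinLinked L K t w' := fun a b p q h' => by
  have := h p q a b (h'.imp Linked.swap Linked.swap)
  linarith

/-- If `t / q` were within `M * (b - a)` to the left of `a`, the greedy choice from `(a, q)` would
keep `q` and link it with a gap of `K` shorter than `(a, b)`. -/
theorem LinkedRight.le_of_minLinked {K L : Set ℝ} (hK : IsCompact K) (hL : IsCompact L)
    (hK0 : (0 : ℝ) ∈ K) (hL0 : (0 : ℝ) ∈ L) {M t a b p q : ℝ} (ht0 : 0 < t)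
    (ht : ∀ x ∈ K, ∀ y ∈ L, x * y ≠ t) (hKM : Thick M K)
    (h : LinkedRight K L t a b p q) (hmin : MinLinked K L t ((b - a) + (q - p))) :
    t ≤ q * (a - M * (b - a)) := by
  by_contra! hlt
  have hgK := h.gapK
  have hgL := h.gapL
  have hq0 : 0 < q := h.p_nonneg.trans_lt hgL.lt
  have ha0 : 0 < a := pos_of_mul_pos_left (ht0.trans h.lt_aq) hq0.le
  obtain ⟨a', b', p', q', hl, hba, hqq⟩ := exists_linkedLeft hK hL hK0 hL0 ht0 ht hgK.left_mem
    hgL.right_mem hq0 h.lt_aq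
  have hl1 := hl.lt_bq
  have hq0' : 0 ≤ q' := hl.p_nonneg.trans hl.gapL.lt.le
  have hqe : q' = q := by
    refine le_antisymm hqq ?_
    rcases hgL.le_or_le q' hl.gapL.right_mem with h1 | h1
    · have := mul_le_mul hba h1 hq0' ha0.le
      linarith [h.ap_lt]
    · exact h1
  have hpp : p ≤ p' := by
    rcases hl.gapL.le_or_le p hgL.left_mem with h1 | h1
    · exact h1
    · linarith [hgL.lt]
  have hb' : a - M * (b - a) < b' := by
    rw [hqe] at hl1
    exact lt_of_mul_lt_mul_right (a := q) (by linarith) hq0.le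
  have := hKM.sub_lt_left hgK hl.gapK hba hb'
  have := hmin _ _ _ _ (Or.inl (Or.inl hl))
  linarith

/-- Here `t / p` cannot be within `M * (b - a)` to the right of `b`: the greedy choice from `(b, p)`
would keep `p` and use a shorter gap of `K`. -/
theorem LinkedLeft.le_of_minLinked {K L : Set ℝ} (hK : IsCompact K) (hL : IsCompact L)
    {M t a b p q : ℝ} (hp0 : 0 < p)
    (ht : ∀ x ∈ K, ∀ y ∈ L, x * y ≠ t) (hKM : Thick M K)
    (h : LinkedLeft K L t a b p q) (hmin : MinLinked K L t ((b - a) + (q - p))) :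
    p * (b + M * (b - a)) ≤ t := by
  by_contra! hlt
  have hgK := h.gapK
  have hgL := h.gapL
  have hb0 : 0 < b := h.a_nonneg.trans_lt hgK.lt
  obtain ⟨z, hz, hzM⟩ := hKM.right _ _ hgK
  obtain ⟨a', b', p', q', hl, hba, hpp⟩ := exists_linkedRight hK hL ht hgK.right_mem
    hgL.left_mem hb0 hp0 h.bp_lt hz hgL.right_mem h.lt_bq.le (by nlinarith)
  have hl1 := hl.ap_lt
  have hpe : p' = p := by
    refine le_antisymm ?_ hpp
    rcases hgL.le_or_le p' hl.gapL.left_mem with h1 | h1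
    · exact h1
    · have := mul_le_mul hba h1 (hp0.trans hgL.lt).le hl.a_nonneg
      linarith [h.lt_bq]
  have hqq : q' ≤ q := by
    rcases hl.gapL.le_or_le q hgL.right_mem with h1 | h1
    · linarith [hgL.lt]
    · exact h1
  have ha' : a' < b + M * (b - a) := by
    rw [hpe] at hl1
    exact lt_of_mul_lt_mul_right (a := p) (by linarith) hp0.le
  have := hKM.sub_lt_right hgK hl.gapK hba ha'
  have := hmin _ _ _ _ (Or.inl (Or.inr hl))
  linarith

/-- If the parts of `K` and `L` to the left of a smallest linked pair reach far into the negative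
numbers, they contain a smaller linked pair there. -/
theorem LinkedLeft.not_lt_of_minLinked {K L : Set ℝ} (hK : IsCompact K) (hL : IsCompact L)
    (hK0 : (0 : ℝ) ∈ K) (hL0 : (0 : ℝ) ∈ L) {M N t a b p q : ℝ} (ht0 : 0 < t)
    (ht : ∀ x ∈ K, ∀ y ∈ L, x * y ≠ t) (hKM : Thick M K) 
    (hLN : Thick N L) (h : LinkedLeft K L t a b p q)
    (hmin : MinLinked K L t ((b - a) + (q - p))) (he : 0 < M * (b - a) - a)
    (hf : 0 < N * (q - p) - p) : ¬ t < (M * (b - a) - a) * (N * (q - p) - p) := by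
  intro hlt
  -- `x` is the first point of `-K` at or beyond the overshoot `M * (b - a) - a`. A gap of `-K`
  -- inside `[0, x]` starts before the overshoot, hence its reflection is close enough to `(a, b)`
  -- to be shorter.
  have key : ∀ {K : Set ℝ}, IsCompact K → ∀ {M a b : ℝ}, Thick M K → BddGap K a b →
      0 ≤ a → 0 < M * (b - a) - a → ∃ x ∈ -K, M * (b - a) - a ≤ x ∧
        ∀ c d, BddGap (-K) c d → 0 ≤ c → d ≤ x → d - c < b - a := by
    intro K hK M a b hKM hab ha he
    obtain ⟨z, hz, hzM⟩ := hKM.left _ _ hab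
    obtain ⟨x, ⟨hx1, hx2⟩, hx3⟩ := exists_isLeast_inter_Ici (x := M * (b - a) - a) hK.neg
      (y := -z) (by simpa using hz) (by linarith)
    refine ⟨x, hx1, hx2, fun c d hcd hc hd => ?_⟩
    have hce : c < M * (b - a) - a := by
      by_contra! hle
      have := hx3 ⟨hcd.left_mem, hle⟩
      linarith [hcd.lt]
    have := hKM.sub_lt_left hab (bddGap_neg_iff.1 hcd) (by linarith) (by linarith)
    linarith
  obtain ⟨x, hx, hxe, hxs⟩ := key hK hKM h.gapK h.a_nonneg he
  obtain ⟨y, hy, hyf, hys⟩ := key hL hLN h.gapL h.p_nonneg hf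
  obtain ⟨a', b', p', q', hl, hbx, hqy⟩ := exists_linkedLeft hK.neg hL.neg (by simpa using hK0)
    (by simpa using hL0) ht0 (fun x hx y hy => by simpa using ht (-x) hx (-y) hy) hx hy
    (hf.trans_le hyf) (hlt.trans_le (mul_le_mul hxe hyf hf.le (he.le.trans hxe)))
  have h1 := hxs _ _ hl.gapK hl.a_nonneg hbx
  have h2 := hys _ _ hl.gapL hl.p_nonneg hqy
  have := hmin _ _ _ _ (Or.inr (Or.inl hl))
  linarith

/-! ### The inequality behind the thickness condition -/

theorem quadratic_nonneg_of_endpoints {A B C l x u : ℝ} (hA : 0 ≤ A) (hl : l ≤ x) (hu : x ≤ u)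
    (h1 : 0 ≤ -A * l ^ 2 + B * l + C) (h2 : 0 ≤ -A * u ^ 2 + B * u + C) :
    0 ≤ -A * x ^ 2 + B * x + C := by
  rcases hl.eq_or_lt with rfl | hl
  · exact h1
  have h3 : 0 < u - l := by linarith
  have e : (u - l) * (-A * x ^ 2 + B * x + C) = (u - x) * (-A * l ^ 2 + B * l + C) +
      (x - l) * (-A * u ^ 2 + B * u + C) + A * ((u - x) * (x - l) * (u - l)) := by ring
  refine nonneg_of_mul_nonneg_right (a := u - l) ?_ h3
  rw [e]
  have e1 : 0 ≤ u - x := by linarith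
  have e2 : 0 ≤ x - l := by linarith
  positivity

theorem one_lt_mul_of_thickness_condition {M N : ℝ} (hM : 0 ≤ M) (hN : 0 ≤ N)
    (h : 2 * (M + 1) * (N + 1) ≤ (M * N - 1) ^ 2) : 1 < M * N := by
  have := mul_nonneg hM hN
  by_contra! hle
  nlinarith

/-- This is the left-linked case scaled to `a = p = 1`, `b = 1 + X`, `q = 1 + Y`, `t = 1 + S`.
Eliminating `Y` through `Y * (1 + X) > S - X` leaves a concave quadratic in `X`, which is checked at
the ends of the range of `X`. -/
theorem normalized_inequality {M N S X Y : ℝ} (hM : 0 < M) (hN : 0 < N) (hMN : 1 < M * N)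
    (h : 2 * (M + 1) * (N + 1) ≤ (M * N - 1) ^ 2) (hX0 : 0 < X) (hY0 : 0 < Y)
    (hX : X * (M + 1) ≤ S) (hY : Y * (N + 1) ≤ S) (hXY : S < X * Y + X + Y) :
    1 < M * X ∧ 1 < N * Y ∧ 1 + S < (M * X - 1) * (N * Y - 1) := by
  have hS0 : 0 < S := by nlinarith
  have hS : M * N - 1 < S := by
    have h1 : (X * (M + 1)) * (Y * (N + 1)) ≤ S * S := mul_le_mul hX hY (by positivity) hS0.le
    have h2 : S * ((M + 1) * (N + 1)) < S * (S + M + 1 + N + 1) := by nlinarith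
    have := lt_of_mul_lt_mul_left h2 hS0.le
    nlinarith
  have hSS : (M * N - 1) ^ 2 < S * (M * N - 1) := by nlinarith
  -- Insert the upper bound `Y ≤ S / (N + 1)` into `S - X < Y * (1 + X)`; `lowY` is symmetric.
  have lowX : N * S < X * (N + 1 + S) := by nlinarith
  have lowY : M * S < Y * (M + 1 + S) := by nlinarith
  have hMX : 1 < M * X := by
    have : 1 * (N + 1 + S) < (M * X) * (N + 1 + S) := by nlinarith [mul_pos hM hN]
    exact lt_of_mul_lt_mul_right this (by positivity)
  have hNY : 1 < N * Y := by
    have : 1 * (M + 1 + S) < (N * Y) * (M + 1 + S) := by nlinarith [mul_pos hM hN]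
    exact lt_of_mul_lt_mul_right this (by positivity)
  refine ⟨hMX, hNY, ?_⟩
  -- Up to a positive factor, this is nonnegativity of the quadratic at `X = S / (M + 1)`; with `M`
  -- and `N` exchanged it is the other end, where `Y = S / (N + 1)`. At `S = M * N - 1` it is the
  -- thickness condition times `M`.
  have endpoint : ∀ {M N : ℝ}, 0 < M → 0 < N → 1 < M * N →
      2 * (M + 1) * (N + 1) ≤ (M * N - 1) ^ 2 → M * N - 1 < S →
      (M + 1) * (2 * M + 1 + M * N) ≤ S * (M ^ 2 * N - 2 * M - 1) := by
    intro M N hM hN hMN h hS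
    have e : (M * N - 1) * (M ^ 2 * N - 2 * M - 1) - (M + 1) * (2 * M + 1 + M * N) =
      M * ((M * N - 1) ^ 2 - 2 * (M + 1) * (N + 1)) := by ring
    have e1 : 0 ≤ M * ((M * N - 1) ^ 2 - 2 * (M + 1) * (N + 1)) :=
      mul_nonneg hM.le (by linarith)
    have e2 : 0 < (M + 1) * (2 * M + 1 + M * N) := by positivity
    have e3 : 0 < M ^ 2 * N - 2 * M - 1 :=
      pos_of_mul_pos_right (a := M * N - 1) (by linarith) (by linarith)
    nlinarith
  have hq : 0 ≤ -(M * N + M) * X ^ 2 + (M * N * S - M + N - S) * X + (-(N * S) - S) := by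
    refine quadratic_nonneg_of_endpoints (l := N * S / (N + 1 + S)) (u := S / (M + 1))
      (by positivity) ((div_le_iff₀ (by positivity)).2 lowX.le)
      ((le_div_iff₀ (by positivity)).2 hX) ?_ ?_
    · have e := endpoint hN hM (by linarith) (by linarith) (by linarith)
      have : -(M * N + M) * (N * S / (N + 1 + S)) ^ 2 +
          (M * N * S - M + N - S) * (N * S / (N + 1 + S)) + (-(N * S) - S) =
          S * (1 + S) * (N + 1) * (S * (N ^ 2 * M - 2 * N - 1) - (N + 1) * (2 * N + 1 + N * M)) /
          ((N + 1) * (N + 1 + S) ^ 2) := by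
        field_simp
        ring
      rw [this]
      have : 0 ≤ S * (N ^ 2 * M - 2 * N - 1) - (N + 1) * (2 * N + 1 + N * M) := by linarith
      positivity
    · have e := endpoint hM hN hMN h hS
      have : -(M * N + M) * (S / (M + 1)) ^ 2 +
          (M * N * S - M + N - S) * (S / (M + 1)) + (-(N * S) - S) =
          S * (S * (M ^ 2 * N - 2 * M - 1) - (M + 1) * (2 * M + 1 + M * N)) / (M + 1) ^ 2 := by
        field_simp
        ring
      rw [this]
      have : 0 ≤ S * (M ^ 2 * N - 2 * M - 1) - (M + 1) * (2 * M + 1 + M * N) := by linarith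
      positivity
  have hY' : N * (M * X - 1) * (S - X) < N * (M * X - 1) * (Y * (1 + X)) :=
    mul_lt_mul_of_pos_left (by linarith) (mul_pos hN (by linarith))
  have : (1 + X) * (1 + S) < (1 + X) * ((M * X - 1) * (N * Y - 1)) := by nlinarith
  exact lt_of_mul_lt_mul_left this (by positivity)

/-! ### The product is an interval -/

/-- The properties of a `0`-Cantor set that are used for the gap argument. -/
structure ThickAtZero (M : ℝ) (K : Set ℝ) : Prop where
  compact : IsCompact K
  thick : Thick M K
  zero_mem : (0 : ℝ) ∈ K
  exists_pos : ∀ ε > 0, ∃ x ∈ K, 0 < x ∧ x < ε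
  exists_neg : ∀ ε > 0, ∃ x ∈ K, x < 0 ∧ -ε < x

theorem ThickAtZero.neg {M : ℝ} {K : Set ℝ} (h : ThickAtZero M K) : ThickAtZero M (-K) where
  compact := h.compact.neg
  thick := h.thick.neg
  zero_mem := by simpa using h.zero_mem
  exists_pos ε hε := by
    obtain ⟨x, hx, h1, h2⟩ := h.exists_neg ε hε
    exact ⟨-x, by simpa using hx, by linarith, by linarith⟩
  exists_neg ε hε := by
    obtain ⟨x, hx, h1, h2⟩ := h.exists_pos ε hε
    exact ⟨-x, by simpa using hx, by linarith, by linarith⟩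

theorem ThickAtZero.pos_of_bddGap {M : ℝ} {K : Set ℝ} (h : ThickAtZero M K) {a b : ℝ}
    (hab : BddGap K a b) (ha : 0 ≤ a) : 0 < a := by
  refine lt_of_le_of_ne ha fun h0 => ?_
  obtain ⟨x, hx, h1, h2⟩ := h.exists_pos (b - a) (sub_pos.2 hab.lt)
  rcases hab.le_or_le x hx with h3 | h3 <;> linarith

theorem ThickAtZero.not_minLinked {M N t a b p q : ℝ} {K L : Set ℝ} (hK : ThickAtZero M K)
    (hL : ThickAtZero N L) (hM : 0 < M) (hN : 0 < N) (hMN : 1 < M * N)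
    (hcond : 2 * (M + 1) * (N + 1) ≤ (M * N - 1) ^ 2) (ht0 : 0 < t)
    (ht : ∀ x ∈ K, ∀ y ∈ L, x * y ≠ t) (h : Linked K L t a b p q) :
    ¬ MinLinked K L t ((b - a) + (q - p)) := by
  intro hmin
  have ht' : ∀ y ∈ L, ∀ x ∈ K, y * x ≠ t := fun y hy x hx => by
    rw [mul_comm]; exact ht x hx y hy
  have hmin' : MinLinked L K t ((q - p) + (b - a)) := hmin.swap (add_comm _ _)
  rcases h with h | h
  · have ha := hK.pos_of_bddGap h.gapK h.a_nonneg
    have hp := hL.pos_of_bddGap h.gapL h.p_nonneg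
    have h1 := h.le_of_minLinked hK.compact hL.compact hp ht hK.thick hmin
    have h2 := h.swap.le_of_minLinked hL.compact hK.compact ha ht' hL.thick hmin'
    have hab := h.gapK.lt
    have hpq := h.gapL.lt
    have hlt := h.lt_bq
    obtain ⟨X, hX⟩ : ∃ X, X = (b - a) / a := ⟨_, rfl⟩
    obtain ⟨Y, hY⟩ : ∃ Y, Y = (q - p) / p := ⟨_, rfl⟩
    obtain ⟨S, hS⟩ : ∃ S, S = t / (a * p) - 1 := ⟨_, rfl⟩
    have hX0 : 0 < X := hX ▸ div_pos (by linarith) ha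
    have hY0 : 0 < Y := hY ▸ div_pos (by linarith) hp
    have hb : b = a * (1 + X) := by rw [hX]; field_simp; ring
    have hq : q = p * (1 + Y) := by rw [hY]; field_simp; ring
    have hts : t = a * p * (1 + S) := by rw [hS]; field_simp; ring
    have hap : 0 < a * p := mul_pos ha hp
    subst hb hq hts
    obtain ⟨e1, e2, e3⟩ := normalized_inequality (S := S) hM hN hMN hcond hX0 hY0
      (le_of_mul_le_mul_left (by linarith) hap) (le_of_mul_le_mul_left (by linarith) hap)
      (lt_of_mul_lt_mul_left (a := a * p) (by linarith) hap.le)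
    have f1 : M * (a * (1 + X) - a) - a = a * (M * X - 1) := by ring
    have f2 : N * (p * (1 + Y) - p) - p = p * (N * Y - 1) := by ring
    refine h.not_lt_of_minLinked hK.compact hL.compact hK.zero_mem hL.zero_mem ht0 ht hK.thick
      hL.thick hmin ?_ ?_ ?_
    · rw [f1]; exact mul_pos ha (by linarith)
    · rw [f2]; exact mul_pos hp (by linarith)
    · rw [f1, f2]
      have := mul_lt_mul_of_pos_left e3 hap
      linarith
  · have h1 := h.le_of_minLinked hK.compact hL.compact hK.zero_mem hL.zero_mem ht0 ht hK.thick hmin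
    have h2 := h.swap.le_of_minLinked hL.compact hK.compact hL.zero_mem hK.zero_mem ht0 ht'
      hL.thick hmin'
    have hab := h.gapK.lt
    have hpq := h.gapL.lt
    have hlt := h.ap_lt
    have ha := h.a_nonneg
    have hp := h.p_nonneg
    have e1 : p * (M * (b - a)) ≤ a * (q - p) := by nlinarith [mul_nonneg hM.le (sub_pos.2 hab).le]
    have e2 : a * (N * (q - p)) ≤ p * (b - a) := by nlinarith [mul_nonneg hN.le (sub_pos.2 hpq).le]
    have ha := hK.pos_of_bddGap h.gapK h.a_nonneg
    have hp := hL.pos_of_bddGap h.gapL h.p_nonneg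
    -- Chaining the two minimality bounds forces `M * N ≤ 1`.
    have e3 : M * N * (p * (b - a)) ≤ p * (b - a) := by
      nlinarith [mul_le_mul_of_nonneg_left e1 hN.le]
    nlinarith [mul_pos hp (sub_pos.2 hab)]

theorem ThickAtZero.exists_mul_eq {M N : ℝ} {K L : Set ℝ} (hK : ThickAtZero M K)
    (hL : ThickAtZero N L) (hM : 0 ≤ M) (hN : 0 ≤ N)
    (hcond : 2 * (M + 1) * (N + 1) ≤ (M * N - 1) ^ 2) {t x y : ℝ} (ht0 : 0 < t)
    (hx : x ∈ K) (hy : y ∈ L) (hy0 : 0 < y) (hxy : t ≤ x * y) : t ∈ K * L := by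
  have hMN := one_lt_mul_of_thickness_condition hM hN hcond
  have hM0 : 0 < M := pos_of_mul_pos_left (zero_lt_one.trans hMN) hN
  have hN0 : 0 < N := pos_of_mul_pos_right (zero_lt_one.trans hMN) hM
  by_contra hnot
  have ht : ∀ x ∈ K, ∀ y ∈ L, x * y ≠ t := fun x hx y hy h => hnot (h ▸ Set.mul_mem_mul hx hy)
  have ht' : ∀ x ∈ -K, ∀ y ∈ -L, x * y ≠ t := fun x hx y hy => by
    simpa using ht (-x) hx (-y) hy
  obtain ⟨a, b, p, q, hl, -⟩ := exists_linkedLeft hK.compact hL.compact hK.zero_mem hL.zero_mem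
    ht0 ht hx hy hy0 (lt_of_le_of_ne hxy (ht x hx y hy).symm)
  obtain ⟨⟨a, b, p, q⟩, hv, hmin⟩ := ((isCompact_linkedSet hK.compact hL.compact t).union
    (isCompact_linkedSet hK.compact.neg hL.compact.neg t)).exists_isMinOn
      ⟨(a, b, p, q), Or.inl ((mem_linkedSet ht).2 (Or.inl hl))⟩
      (f := fun v => (v.2.1 - v.1) + (v.2.2.2 - v.2.2.1)) (by fun_prop)
  have hmin' : ∀ a' b' p' q', Linked K L t a' b' p' q' ∨ Linked (-K) (-L) t a' b' p' q' →
      (b - a) + (q - p) ≤ (b' - a') + (q' - p') := fun a' b' p' q' h' =>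
    isMinOn_iff.1 hmin (a', b', p', q') (h'.imp (mem_linkedSet ht).2 (mem_linkedSet ht').2)
  rcases hv with hv | hv
  · exact hK.not_minLinked hL hM0 hN0 hMN hcond ht0 ht ((mem_linkedSet ht).1 hv) hmin'
  -- A minimizer on the negative side is one on the positive side for `-K` and `-L`.
  · refine hK.neg.not_minLinked hL.neg hM0 hN0 hMN hcond ht0 ht' ((mem_linkedSet ht').1 hv) ?_
    intro a' b' p' q' h'
    rw [neg_neg, neg_neg] at h'
    exact hmin' a' b' p' q' h'.symm

theorem exists_mem_lt_of_sInf_eq_zero {s : Set ℝ} (hs : s.Nonempty) (h : sInf s = 0) {ε : ℝ}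
    (hε : 0 < ε) : ∃ x ∈ s, x < ε :=
  exists_lt_of_csInf_lt hs (h ▸ hε)

theorem IsZeroCantorSet.thickAtZero {K : Set ℝ} (hK : IsZeroCantorSet K) :
    ThickAtZero (thickness K) K := by
  have hpos : ∀ ε > 0, ∃ x ∈ K, 0 < x ∧ x < ε := fun ε hε => by
    obtain ⟨x, hx, h⟩ := exists_mem_lt_of_sInf_eq_zero hK.posPart_nonempty hK.sInf_posPart hε
    exact ⟨x, hx.1, hx.2, h⟩
  refine ⟨hK.isCantorSet.compact, hK.isCantorSet.thick, ?_, hpos, fun ε hε => ?_⟩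
  · rw [← hK.isCantorSet.compact.isClosed.closure_eq, Metric.mem_closure_iff]
    intro ε hε
    obtain ⟨x, hx, h1, h2⟩ := hpos ε hε
    exact ⟨x, hx, by rwa [dist_zero_left, Real.norm_eq_abs, abs_of_pos h1]⟩
  · obtain ⟨x, hx, h⟩ := exists_mem_lt_of_sInf_eq_zero hK.negPart_nonempty hK.sInf_negPart hε
    have hx1 : -x ∈ K := hx.1
    have hx2 : -x < 0 := hx.2
    exact ⟨-x, hx1, hx2, by linarith⟩

theorem IsZeroCantorSet.exists_mul_eq_Icc {K L : Set ℝ} (hK : IsZeroCantorSet K)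
    (hL : IsZeroCantorSet L)
    (hcond : 2 * (thickness K + 1) * (thickness L + 1) ≤ (thickness K * thickness L - 1) ^ 2) :
    ∃ a b : ℝ, a < b ∧ K * L = Set.Icc a b := by
  have hK' := hK.thickAtZero
  have hL' := hL.thickAtZero
  have hM := thickness_nonneg K
  have hN := thickness_nonneg L
  have hcomp : IsCompact (K * L) := hK'.compact.mul hL'.compact
  have h0 : (0 : ℝ) ∈ K * L := ⟨0, hK'.zero_mem, 0, hL'.zero_mem, mul_zero 0⟩
  obtain ⟨m, hm⟩ := hcomp.exists_isLeast ⟨0, h0⟩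
  obtain ⟨n, hn⟩ := hcomp.exists_isGreatest ⟨0, h0⟩
  have step : ∀ {K L : Set ℝ} {M N : ℝ}, ThickAtZero M K → ThickAtZero N L → 0 ≤ M → 0 ≤ N →
      2 * (M + 1) * (N + 1) ≤ (M * N - 1) ^ 2 → ∀ {t n : ℝ}, 0 < t → t ≤ n → n ∈ K * L →
      t ∈ K * L := by
    rintro K L M N hK hL hM hN hcond t n ht htn ⟨x, hx, y, hy, rfl⟩
    rcases lt_trichotomy y 0 with hy0 | rfl | hy0
    · have := hK.neg.exists_mul_eq hL.neg hM hN hcond ht (x := -x) (y := -y) (by simpa using hx)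
        (by simpa using hy) (by linarith) (by simpa using htn)
      obtain ⟨x', hx', y', hy', h⟩ := this
      exact ⟨-x', hx', -y', hy', by simpa using h⟩
    · simp only [mul_zero] at htn
      linarith
    · exact hK.exists_mul_eq hL hM hN hcond ht hx hy hy0 htn
  obtain ⟨x, hx, hx0, -⟩ := hK'.exists_pos 1 one_pos
  obtain ⟨y, hy, hy0, -⟩ := hL'.exists_pos 1 one_pos
  have hn0 : 0 < n := (mul_pos hx0 hy0).trans_le (hn.2 (Set.mul_mem_mul hx hy))
  refine ⟨m, n, (hm.2 h0).trans_lt hn0, Set.Subset.antisymm (fun t ht => ⟨hm.2 ht, hn.2 ht⟩) ?_⟩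
  rintro t ⟨h1, h2⟩
  rcases lt_trichotomy t 0 with ht | rfl | ht
  · obtain ⟨x, hx, y, hy, hxy⟩ := hm.1
    -- A negative `t` is handled as `-t` in `K * (-L)`.
    obtain ⟨x', hx', y', hy', h⟩ := step hK' hL'.neg hM hN hcond (t := -t) (n := -m)
      (by linarith) (by linarith) ⟨x, hx, -y, by simpa using hy, by simpa using hxy⟩
    refine ⟨x', hx', -y', hy', ?_⟩
    have h : x' * y' = -t := h
    change x' * -y' = t
    linarith
  · exact h0
  · exact step hK' hL' hM hN hcond ht h2 hn.1

theorem thickness_condition_of_eq {M : ℝ} (h : 1 + Real.sqrt 2 ≤ M) :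
    2 * (M + 1) * (M + 1) ≤ (M * M - 1) ^ 2 := by
  have h2 : Real.sqrt 2 ^ 2 = 2 := Real.sq_sqrt (by norm_num)
  have h3 : 2 ≤ (M - 1) ^ 2 := by nlinarith [Real.sqrt_nonneg 2]
  nlinarith [mul_le_mul_of_nonneg_right h3 (sq_nonneg (M + 1))]

/-! ### Middle Cantor sets -/

/-- `C` is the Cantor set in `[0, 1]` that consists of its two copies `ρ C` and `1 - ρ + ρ C`. -/
structure IsMiddleCantor (ρ : ℝ) (C : Set ℝ) : Prop where
  compact : IsCompact C
  subset_Icc : C ⊆ Set.Icc 0 1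
  zero_mem : (0 : ℝ) ∈ C
  one_mem : (1 : ℝ) ∈ C
  mem_iff : ∀ x, x ∈ C ↔ (∃ y ∈ C, x = ρ * y) ∨ ∃ y ∈ C, x = 1 - ρ + ρ * y

-- The set consists of the sums of subseries of `∑ (1 - ρ) * ρ ^ n`. It is compact as a continuous
-- image of `ℕ → Bool`, and the first digit selects one of the two copies.
open Classical in
theorem exists_isMiddleCantor {ρ : ℝ} (h0 : 0 < ρ) (h1 : ρ < 1) : ∃ C, IsMiddleCantor ρ C := by
  let F : ℕ → (ℕ → Bool) → ℝ := fun n a => if a n then (1 - ρ) * ρ ^ n else 0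
  have hg : HasSum (fun n => (1 - ρ) * ρ ^ n) 1 := by
    have := (hasSum_geometric_of_lt_one h0.le h1).mul_left (1 - ρ)
    rwa [mul_inv_cancel₀ (by linarith : (1 - ρ) ≠ 0)] at this
  have hnn : ∀ n a, 0 ≤ F n a := fun n a => by
    dsimp only [F]
    split_ifs
    · exact mul_nonneg (by linarith) (by positivity)
    · exact le_rfl
  have hle : ∀ n a, F n a ≤ (1 - ρ) * ρ ^ n := fun n a => by
    dsimp only [F]
    split_ifs
    · exact le_rfl
    · exact mul_nonneg (by linarith) (by positivity)
  have hsum : ∀ a, Summable fun n => F n a := fun a =>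
    Summable.of_nonneg_of_le (fun n => hnn n a) (fun n => hle n a) hg.summable
  have hcont : Continuous fun a => ∑' n, F n a := by
    refine continuous_tsum (fun n => ?_) hg.summable fun n a => ?_
    · exact (continuous_of_discreteTopology (f := fun b : Bool =>
        if b then (1 - ρ) * ρ ^ n else 0)).comp (continuous_apply n)
    · rw [Real.norm_eq_abs, abs_of_nonneg (hnn n a)]
      exact hle n a
  have hstep : ∀ a : ℕ → Bool, ∑' n, F n a =
      (if a 0 then 1 - ρ else 0) + ρ * ∑' n, F n fun k => a (k + 1) := fun a => by
    rw [(hsum a).tsum_eq_zero_add, ← tsum_mul_left]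
    congr 1
    · simp [F]
    · refine tsum_congr fun n => ?_
      simp only [F, mul_ite, mul_zero]
      congr 1
      ring
  refine ⟨Set.range fun a => ∑' n, F n a, isCompact_range hcont, ?_, ⟨fun _ => false, ?_⟩,
    ⟨fun _ => true, ?_⟩, fun x => ⟨?_, ?_⟩⟩
  · rintro _ ⟨a, rfl⟩
    exact ⟨tsum_nonneg fun n => hnn n a, by
      rw [← hg.tsum_eq]
      exact (hsum a).tsum_le_tsum (fun n => hle n a) hg.summable⟩
  · simp [F]
  · simpa [F] using hg.tsum_eq
  · rintro ⟨a, rfl⟩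
    dsimp only
    rw [hstep a]
    cases h : a 0
    · exact Or.inl ⟨_, ⟨fun k => a (k + 1), rfl⟩, by simp⟩
    · exact Or.inr ⟨_, ⟨fun k => a (k + 1), rfl⟩, by simp⟩
  · rintro (⟨_, ⟨a, rfl⟩, rfl⟩ | ⟨_, ⟨a, rfl⟩, rfl⟩)
    · exact ⟨fun n => Nat.casesOn n false a, by dsimp only; rw [hstep]; simp⟩
    · exact ⟨fun n => Nat.casesOn n true a, by dsimp only; rw [hstep]; simp⟩

namespace IsMiddleCantor

variable {ρ : ℝ} {C : Set ℝ}

theorem left_mem (hC : IsMiddleCantor ρ C) {x : ℝ} (hx : x ∈ C) : ρ * x ∈ C :=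
  (hC.mem_iff _).2 (Or.inl ⟨x, hx, rfl⟩)

theorem right_mem (hC : IsMiddleCantor ρ C) {x : ℝ} (hx : x ∈ C) : 1 - ρ + ρ * x ∈ C :=
  (hC.mem_iff _).2 (Or.inr ⟨x, hx, rfl⟩)

theorem pow_mul_mem (hC : IsMiddleCantor ρ C) {x : ℝ} (hx : x ∈ C) (n : ℕ) : ρ ^ n * x ∈ C := by
  induction n with
  | zero => simpa using hx
  | succ n ih =>
    rw [pow_succ', mul_assoc]
    exact hC.left_mem ih

theorem exists_ne_near (hC : IsMiddleCantor ρ C) (h0 : 0 < ρ) (n : ℕ) :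
    ∀ x ∈ C, ∃ y ∈ C, y ≠ x ∧ |y - x| ≤ ρ ^ n := by
  induction n with
  | zero =>
    intro x hx
    have hx' := hC.subset_Icc hx
    by_cases h : x = 0
    · exact ⟨1, hC.one_mem, by rw [h]; exact one_ne_zero, by simp [h]⟩
    · exact ⟨0, hC.zero_mem, Ne.symm h, by simpa [abs_of_nonneg hx'.1] using hx'.2⟩
  | succ n ih =>
    intro x hx
    rcases (hC.mem_iff x).1 hx with ⟨z, hz, rfl⟩ | ⟨z, hz, rfl⟩
    · obtain ⟨y, hy, hne, hd⟩ := ih z hz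
      refine ⟨ρ * y, hC.left_mem hy, fun h => hne (mul_left_cancel₀ h0.ne' h), ?_⟩
      rw [← mul_sub, abs_mul, abs_of_pos h0, pow_succ']
      exact mul_le_mul_of_nonneg_left hd h0.le
    · obtain ⟨y, hy, hne, hd⟩ := ih z hz
      refine ⟨1 - ρ + ρ * y, hC.right_mem hy,
        fun h => hne (mul_left_cancel₀ h0.ne' (add_left_cancel h)), ?_⟩
      rw [add_sub_add_left_eq_sub, ← mul_sub, abs_mul, abs_of_pos h0, pow_succ']
      exact mul_le_mul_of_nonneg_left hd h0.le

/-- An interval inside `C` cannot meet the middle gap, so it lies in one copy; rescaling that copy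
lowers `n`. -/
theorem not_Icc_subset (hC : IsMiddleCantor ρ C) (h0 : 0 < ρ) (h1 : ρ < 1 / 2) (n : ℕ) :
    ∀ u v : ℝ, ρ ^ n < v - u → ¬ Set.Icc u v ⊆ C := by
  induction n with
  | zero =>
    intro u v huv hsub
    rw [pow_zero] at huv
    have hu := hC.subset_Icc (hsub (Set.left_mem_Icc.2 (by linarith)))
    have hv := hC.subset_Icc (hsub (Set.right_mem_Icc.2 (by linarith)))
    linarith [hu.1, hv.2]
  | succ n ih =>
    intro u v huv hsub
    have hpos : 0 < ρ ^ (n + 1) := by positivity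
    rw [pow_succ'] at huv hpos
    have hlr : ∀ z ∈ C, z ≤ ρ ∨ 1 - ρ ≤ z := fun z hz => by
      rcases (hC.mem_iff z).1 hz with ⟨y, hy, rfl⟩ | ⟨y, hy, rfl⟩
      · left; nlinarith [(hC.subset_Icc hy).2]
      · right; nlinarith [(hC.subset_Icc hy).1]
    rcases le_or_gt v ρ with hv | hv
    · refine ih (u / ρ) (v / ρ) ?_ ?_
      · rw [← sub_div, lt_div_iff₀ h0]
        linarith
      · rintro z ⟨hz1, hz2⟩
        rw [div_le_iff₀ h0] at hz1
        rw [le_div_iff₀ h0] at hz2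
        have hzC : ρ * z ∈ C := hsub ⟨by linarith, by linarith⟩
        rcases (hC.mem_iff _).1 hzC with ⟨y, hy, h⟩ | ⟨y, hy, h⟩
        · rwa [mul_left_cancel₀ h0.ne' h]
        · have := mul_nonneg h0.le (hC.subset_Icc hy).1
          linarith
    · rcases le_or_gt (1 - ρ) u with hu | hu
      · refine ih ((u - (1 - ρ)) / ρ) ((v - (1 - ρ)) / ρ) ?_ ?_
        · rw [← sub_div, lt_div_iff₀ h0]
          linarith
        · rintro z ⟨hz1, hz2⟩
          rw [div_le_iff₀ h0] at hz1
          rw [le_div_iff₀ h0] at hz2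
          have hzC : 1 - ρ + ρ * z ∈ C := hsub ⟨by linarith, by linarith⟩
          rcases (hC.mem_iff _).1 hzC with ⟨y, hy, h⟩ | ⟨y, hy, h⟩
          · have h2 := mul_le_mul_of_nonneg_left (hC.subset_Icc hy).2 h0.le
            have h3 : 0 ≤ ρ * z := by linarith
            linarith
          · rwa [mul_left_cancel₀ h0.ne' (add_left_cancel h)]
      · have hm : max u ρ < min v (1 - ρ) :=
          max_lt (lt_min (by linarith) hu) (lt_min hv (by linarith))
        obtain ⟨z, hz1, hz2⟩ := exists_between hm
        rw [max_lt_iff] at hz1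
        rw [lt_min_iff] at hz2
        rcases hlr z (hsub ⟨hz1.1.le, hz2.1.le⟩) with h | h <;> linarith

theorem isCantorSet (hC : IsMiddleCantor ρ C) (h0 : 0 < ρ) (h1 : ρ < 1 / 2) : IsCantorSet C := by
  refine isCantorSet_iff.2 ⟨⟨0, hC.zero_mem⟩, hC.compact, ?_, fun x hx ε hε => ?_⟩
  · rw [Set.eq_empty_iff_forall_notMem]
    intro x hx
    obtain ⟨ε, hε, hb⟩ := Metric.mem_nhds_iff.1 (mem_interior_iff_mem_nhds.1 hx)
    rw [Real.ball_eq_Ioo] at hb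
    obtain ⟨n, hn⟩ := exists_pow_lt_of_lt_one hε (by linarith : ρ < 1)
    refine hC.not_Icc_subset h0 h1 n (x - ε * (2 / 3)) (x + ε * (2 / 3)) (by linarith) ?_
    exact (Set.Icc_subset_Ioo (by linarith) (by linarith)).trans hb
  · obtain ⟨n, hn⟩ := exists_pow_lt_of_lt_one hε (by linarith : ρ < 1)
    obtain ⟨y, hy, hne, hd⟩ := hC.exists_ne_near h0 n x hx
    exact ⟨y, hy, hne, hd.trans_lt hn⟩

theorem bddGap_cases (hC : IsMiddleCantor ρ C) (h0 : 0 < ρ) (h1 : ρ < 1 / 2) {a b : ℝ}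
    (h : BddGap C a b) : (a = ρ ∧ b = 1 - ρ) ∨
      (∃ c d, BddGap C c d ∧ a = ρ * c ∧ b = ρ * d) ∨
      ∃ c d, BddGap C c d ∧ a = 1 - ρ + ρ * c ∧ b = 1 - ρ + ρ * d := by
  have hlt := h.lt
  rcases (hC.mem_iff a).1 h.left_mem with ⟨c, hc, rfl⟩ | ⟨c, hc, rfl⟩
  · rcases (hC.mem_iff b).1 h.right_mem with ⟨d, hd, rfl⟩ | ⟨d, hd, rfl⟩
    · refine Or.inr (Or.inl ⟨c, d, ⟨hc, hd, lt_of_mul_lt_mul_left hlt h0.le, fun z hz => ?_⟩,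
        rfl, rfl⟩)
      exact (h.le_or_le _ (hC.left_mem hz)).imp (le_of_mul_le_mul_left · h0)
        (le_of_mul_le_mul_left · h0)
    · left
      have hc' := mul_le_mul_of_nonneg_left (hC.subset_Icc hc).2 h0.le
      have hd' := mul_nonneg h0.le (hC.subset_Icc hd).1
      constructor
      · rcases h.le_or_le _ (hC.left_mem hC.one_mem) with h2 | h2 <;> linarith
      · rcases h.le_or_le _ (hC.right_mem hC.zero_mem) with h2 | h2 <;> linarith
  · rcases (hC.mem_iff b).1 h.right_mem with ⟨d, hd, rfl⟩ | ⟨d, hd, rfl⟩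
    · have hd' := mul_le_mul_of_nonneg_left (hC.subset_Icc hd).2 h0.le
      have hc' := mul_nonneg h0.le (hC.subset_Icc hc).1
      linarith
    · refine Or.inr (Or.inr ⟨c, d, ⟨hc, hd, lt_of_mul_lt_mul_left (by linarith) h0.le,
        fun z hz => ?_⟩, rfl, rfl⟩)
      exact (h.le_or_le _ (hC.right_mem hz)).imp
        (fun h => le_of_mul_le_mul_left (by linarith) h0)
        (fun h => le_of_mul_le_mul_left (by linarith) h0)

/-- Every gap is reached from the middle one by finitely many contractions: undoing one divides the
length by `ρ`, and lengths are at most `1`. -/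
theorem bddGap_induction (hC : IsMiddleCantor ρ C) (h0 : 0 < ρ) (h1 : ρ < 1 / 2)
    {P : ℝ → ℝ → Prop} (mid : P ρ (1 - ρ))
    (left : ∀ a b, BddGap C a b → P a b → P (ρ * a) (ρ * b))
    (right : ∀ a b, BddGap C a b → P a b → P (1 - ρ + ρ * a) (1 - ρ + ρ * b)) {a b : ℝ}
    (h : BddGap C a b) : P a b := by
  have key : ∀ n : ℕ, ∀ a b, BddGap C a b → ρ ^ n < b - a → P a b := by
    intro n
    induction n with
    | zero =>
      intro a b h hn
      have := (hC.subset_Icc h.left_mem).1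
      have := (hC.subset_Icc h.right_mem).2
      rw [pow_zero] at hn
      linarith
    | succ n ih =>
      intro a b h hn
      rw [pow_succ'] at hn
      rcases hC.bddGap_cases h0 h1 h with ⟨rfl, rfl⟩ | ⟨c, d, hcd, rfl, rfl⟩ | ⟨c, d, hcd, rfl, rfl⟩
      · exact mid
      · exact left _ _ hcd (ih _ _ hcd (lt_of_mul_lt_mul_left (by linarith) h0.le))
      · exact right _ _ hcd (ih _ _ hcd (lt_of_mul_lt_mul_left (by linarith) h0.le))
  obtain ⟨n, hn⟩ := exists_pow_lt_of_lt_one (sub_pos.2 h.lt) (by linarith : ρ < 1)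
  exact key n a b h hn

theorem mul_gap_le (hC : IsMiddleCantor ρ C) (h0 : 0 < ρ) (h1 : ρ < 1 / 2) {T : ℝ}
    (hT : T * (1 - 2 * ρ) ≤ ρ) {a b : ℝ} (h : BddGap C a b) :
    T * (b - a) ≤ a ∧ T * (b - a) ≤ 1 - b := by
  refine hC.bddGap_induction h0 h1 (P := fun a b => T * (b - a) ≤ a ∧ T * (b - a) ≤ 1 - b) ?_ ?_ ?_ h
  · constructor <;> linarith
  · rintro a b - ⟨h2, h3⟩
    have h2 := mul_le_mul_of_nonneg_left h2 h0.le
    have h3 := mul_le_mul_of_nonneg_left h3 h0.le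
    constructor <;> linarith
  · rintro a b - ⟨h2, h3⟩
    have h2 := mul_le_mul_of_nonneg_left h2 h0.le
    have h3 := mul_le_mul_of_nonneg_left h3 h0.le
    constructor <;> linarith

theorem thick (hC : IsMiddleCantor ρ C) (h0 : 0 < ρ) (h1 : ρ < 1 / 2) {T : ℝ} (hT0 : 0 ≤ T)
    (hT : T * (1 - 2 * ρ) ≤ ρ) : Thick T C := by
  refine ⟨fun a b c d hab hcd hbc => ?_, fun a b hab => ⟨0, hC.zero_mem, ?_⟩,
    fun a b hab => ⟨1, hC.one_mem, (hC.mul_gap_le h0 h1 hT hab).2⟩⟩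
  · refine hC.bddGap_induction h0 h1 (P := fun a b => ∀ c d, BddGap C c d → b ≤ c →
      T * min (b - a) (d - c) ≤ c - b) ?_ ?_ ?_ hab c d hcd hbc
    · intro c d hcd hbc
      refine (mul_le_mul_of_nonneg_left (min_le_right _ _) hT0).trans ?_
      rcases hC.bddGap_cases h0 h1 hcd with ⟨rfl, rfl⟩ | ⟨c, d, h, rfl, rfl⟩ | ⟨c, d, h, rfl, rfl⟩
      · linarith
      · have := mul_le_mul_of_nonneg_left (hC.subset_Icc h.left_mem).2 h0.le
        linarith
      · have := mul_le_mul_of_nonneg_left (hC.mul_gap_le h0 h1 hT h).1 h0.le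
        linarith
    · intro a b hab ih c d hcd hbc
      have h2 := mul_le_mul_of_nonneg_left (hC.mul_gap_le h0 h1 hT hab).2 h0.le
      have h3 := mul_le_mul_of_nonneg_left (min_le_left (ρ * b - ρ * a) (d - c)) hT0
      rcases hC.bddGap_cases h0 h1 hcd with ⟨rfl, rfl⟩ | ⟨c, d, h, rfl, rfl⟩ | ⟨c, d, h, rfl, rfl⟩
      · linarith
      · have := mul_le_mul_of_nonneg_left (ih c d h (le_of_mul_le_mul_left hbc h0)) h0.le
        rw [← mul_sub, ← mul_sub, ← mul_min_of_nonneg _ _ h0.le]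
        linarith
      · have := mul_nonneg h0.le (hC.subset_Icc h.left_mem).1
        linarith
    · intro a b hab ih c d hcd hbc
      have h2 := mul_nonneg h0.le (hC.subset_Icc hab.right_mem).1
      rcases hC.bddGap_cases h0 h1 hcd with ⟨rfl, rfl⟩ | ⟨c, d, h, rfl, rfl⟩ | ⟨c, d, h, rfl, rfl⟩
      · linarith
      · have := mul_le_mul_of_nonneg_left (hC.subset_Icc h.left_mem).2 h0.le
        linarith
      · have := mul_le_mul_of_nonneg_left
          (ih c d h (le_of_mul_le_mul_left (by linarith) h0)) h0.le
        rw [add_sub_add_left_eq_sub, add_sub_add_left_eq_sub, add_sub_add_left_eq_sub,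
          ← mul_sub, ← mul_sub, ← mul_min_of_nonneg _ _ h0.le]
        linarith
  · rw [sub_zero]
    exact (hC.mul_gap_le h0 h1 hT hab).1

/-! ### Products of affine copies of a middle Cantor set -/

/-- Nested copies of size `ρ ^ n` keep `t` between their least and greatest products. The first
factor is halved, then the second: `h2` and `h3` say that the two resulting product ranges overlap.
The extra `ρ` in `h3` appears because the first factor is already halved. -/
theorem exists_affine_mul_affine_near (hC : IsMiddleCantor ρ C) (h0 : 0 < ρ)
    (h1 : ρ < 1 / 2) {α β γ δ t : ℝ} (hβ : 0 < β) (hδ : 0 < δ)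
    (h2 : β * (γ + δ) * (1 - 2 * ρ) ≤ δ * α) (h3 : δ * (α + β) * (1 - 2 * ρ) ≤ ρ * β * γ)
    (ht1 : α * γ ≤ t) (ht2 : t ≤ (α + β) * (γ + δ)) (n : ℕ) :
    ∃ u v, (∀ z ∈ C, u + ρ ^ n * z ∈ C) ∧ (∀ z ∈ C, v + ρ ^ n * z ∈ C) ∧
      (α + β * u) * (γ + δ * v) ≤ t ∧
      t ≤ (α + β * (u + ρ ^ n)) * (γ + δ * (v + ρ ^ n)) := by
  induction n with
  | zero => exact ⟨0, 0, by simp, by simp, by simpa using ht1, by simpa using ht2⟩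
  | succ n ih =>
    obtain ⟨u, v, hu, hv, hl, hr⟩ := ih
    obtain ⟨r, hr_def⟩ : ∃ r, r = ρ ^ n := ⟨_, rfl⟩
    have hr0 : 0 < r := hr_def ▸ pow_pos h0 n
    rw [pow_succ]
    simp only [← hr_def] at hu hv hr ⊢
    have hε : 0 ≤ 1 - 2 * ρ := by linarith
    have sub : ∀ u, (∀ z ∈ C, u + r * z ∈ C) → 0 ≤ u ∧ u + r ≤ 1 ∧
        (∀ z ∈ C, u + r * ρ * z ∈ C) ∧ ∀ z ∈ C, u + (1 - ρ) * r + r * ρ * z ∈ C := fun u hu => by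
      refine ⟨?_, ?_, fun z hz => ?_, fun z hz => ?_⟩
      · simpa using (hC.subset_Icc (hu 0 hC.zero_mem)).1
      · simpa using (hC.subset_Icc (hu 1 hC.one_mem)).2
      · convert hu _ (hC.left_mem hz) using 1; ring
      · convert hu _ (hC.right_mem hz) using 1; ring
    obtain ⟨hu0, hu1, hul, hur⟩ := sub u hu
    obtain ⟨hv0, hv1, hvl, hvr⟩ := sub v hv
    have hX : ∃ u', 0 ≤ u' ∧ u' ≤ 1 ∧ (∀ z ∈ C, u' + r * ρ * z ∈ C) ∧
        (α + β * u') * (γ + δ * v) ≤ t ∧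
        t ≤ (α + β * (u' + r * ρ)) * (γ + δ * (v + r)) := by
      rcases le_or_gt t ((α + β * (u + r * ρ)) * (γ + δ * (v + r))) with h | h
      · exact ⟨u, hu0, by linarith, hul, hl, h⟩
      · refine ⟨u + (1 - ρ) * r, by nlinarith, by nlinarith, hur, ?_, ?_⟩
        · refine le_trans ?_ h.le
          have e1 : β * (γ + δ * v) * (1 - 2 * ρ) ≤ δ * (α + β * (u + r * ρ)) := by
            have : β * (γ + δ * v) * (1 - 2 * ρ) ≤ β * (γ + δ) * (1 - 2 * ρ) := by
              gcongr
              nlinarith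
            have : 0 ≤ δ * (β * (u + r * ρ)) := by positivity
            linarith
          have := mul_le_mul_of_nonneg_left e1 hr0.le
          linarith
        · convert hr using 3; ring
    obtain ⟨u', hu'0, hu'1, hu'C, hl', hr'⟩ := hX
    rcases le_or_gt t ((α + β * (u' + r * ρ)) * (γ + δ * (v + r * ρ))) with h | h
    · exact ⟨u', v, hu'C, hvl, hl', h⟩
    · refine ⟨u', v + (1 - ρ) * r, hu'C, hvr, ?_, ?_⟩
      · refine le_trans ?_ h.le
        have e1 : δ * (α + β * u') * (1 - 2 * ρ) ≤ ρ * β * (γ + δ * (v + r * ρ)) := by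
          have : δ * (α + β * u') * (1 - 2 * ρ) ≤ δ * (α + β) * (1 - 2 * ρ) := by
            gcongr
            nlinarith
          have : 0 ≤ ρ * β * (δ * (v + r * ρ)) := by positivity
          linarith
        have := mul_le_mul_of_nonneg_left e1 hr0.le
        linarith
      · convert hr' using 3; ring

theorem exists_affine_mul_affine_eq (hC : IsMiddleCantor ρ C) (h0 : 0 < ρ)
    (h1 : ρ < 1 / 2) {α β γ δ t : ℝ} (hα : 0 < α) (hβ : 0 < β) (hγ : 0 < γ) (hδ : 0 < δ)
    (h2 : β * (γ + δ) * (1 - 2 * ρ) ≤ δ * α) (h3 : δ * (α + β) * (1 - 2 * ρ) ≤ ρ * β * γ)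
    (ht1 : α * γ ≤ t) (ht2 : t ≤ (α + β) * (γ + δ)) :
    ∃ x ∈ C, ∃ y ∈ C, (α + β * x) * (γ + δ * y) = t := by
  have hcl : IsClosed ((fun v : ℝ × ℝ => (α + β * v.1) * (γ + δ * v.2)) '' (C ×ˢ C)) :=
    ((hC.compact.prod hC.compact).image (by fun_prop)).isClosed
  have hmem : t ∈ (fun v : ℝ × ℝ => (α + β * v.1) * (γ + δ * v.2)) '' (C ×ˢ C) := by
    rw [← hcl.closure_eq, Metric.mem_closure_iff]
    intro ε hε
    obtain ⟨D, hD⟩ : ∃ D, D = β * (γ + δ) + δ * (α + β) := ⟨_, rfl⟩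
    have hD0 : 0 < D := by rw [hD]; positivity
    obtain ⟨n, hn⟩ := exists_pow_lt_of_lt_one (div_pos hε hD0) (by linarith : ρ < 1)
    rw [lt_div_iff₀ hD0] at hn
    obtain ⟨u, v, hu, hv, hl, hr⟩ :=
      hC.exists_affine_mul_affine_near h0 h1 hβ hδ h2 h3 ht1 ht2 n
    have hu0 := hu 0 hC.zero_mem
    have hv0 := hv 0 hC.zero_mem
    have hu1 := (hC.subset_Icc (hu 1 hC.one_mem)).2
    have hv1 := (hC.subset_Icc (hv 1 hC.one_mem)).2
    simp only [mul_zero, add_zero, mul_one] at hu0 hv0 hu1 hv1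
    refine ⟨_, ⟨(u, v), ⟨hu0, hv0⟩, rfl⟩, ?_⟩
    have hu2 := (hC.subset_Icc hu0).1
    rw [Real.dist_eq, abs_of_nonneg (by linarith)]
    have hp : 0 < ρ ^ n := pow_pos h0 n
    have e1 : β * ρ ^ n * (γ + δ * (v + ρ ^ n)) ≤ β * ρ ^ n * (γ + δ) := by
      gcongr
      nlinarith
    have e2 : δ * ρ ^ n * (α + β * u) ≤ δ * ρ ^ n * (α + β) := by
      gcongr
      nlinarith
    have e3 : ρ ^ n * D = β * ρ ^ n * (γ + δ) + δ * ρ ^ n * (α + β) := by rw [hD]; ring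
    dsimp only
    linarith
  obtain ⟨⟨x, y⟩, ⟨hx, hy⟩, h⟩ := hmem
  exact ⟨x, hx, y, hy, h⟩

/-- The right copy `1 - ρ + ρ C` yields all products in `[(1 - ρ) * γ, γ + δ]`; by `h4` this
contains `[ρ * (γ + δ), γ + δ]`, whose multiples by `ρ ^ n` cover `(0, γ + δ]`. -/
theorem exists_mul_affine_eq (hC : IsMiddleCantor ρ C) (h0 : 0 < ρ) (h1 : ρ < 1 / 2)
    {γ δ t : ℝ} (hγ : 0 < γ) (hδ : 0 < δ) (h2 : ρ * (γ + δ) * (1 - 2 * ρ) ≤ δ * (1 - ρ))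
    (h3 : δ * (1 - 2 * ρ) ≤ ρ * ρ * γ) (h4 : (1 - ρ) * γ ≤ ρ * (γ + δ))
    (ht1 : 0 ≤ t) (ht2 : t ≤ γ + δ) : ∃ x ∈ C, ∃ y ∈ C, x * (γ + δ * y) = t := by
  rcases ht1.eq_or_lt with rfl | ht0
  · exact ⟨0, hC.zero_mem, 0, hC.zero_mem, zero_mul _⟩
  have hs : 0 < γ + δ := by linarith
  obtain ⟨n, hn1, hn2⟩ := exists_nat_pow_near_of_lt_one (div_pos ht0 hs)
    ((div_le_one hs).2 ht2) h0 (by linarith)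
  rw [lt_div_iff₀ hs] at hn1
  rw [div_le_iff₀ hs] at hn2
  have hp : 0 < ρ ^ n := pow_pos h0 n
  obtain ⟨x, hx, y, hy, h⟩ := hC.exists_affine_mul_affine_eq h0 h1 (α := 1 - ρ) (β := ρ)
    (γ := γ) (δ := δ) (t := t / ρ ^ n) (by linarith) h0 hγ hδ h2 (by linarith)
    (by rw [le_div_iff₀ hp]; rw [pow_succ] at hn1; nlinarith)
    (by rw [div_le_iff₀ hp]; linarith)
  refine ⟨ρ ^ n * (1 - ρ + ρ * x), hC.pow_mul_mem (hC.right_mem hx) n, y, hy, ?_⟩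
  rw [mul_assoc, h]
  field_simp

end IsMiddleCantor

/-! ### Affine images and unions -/

theorem BddGap.of_image_affine {K : Set ℝ} {u v a b : ℝ} (hv : 0 < v)
    (h : BddGap ((fun z => u + v * z) '' K) a b) :
    ∃ c d, BddGap K c d ∧ a = u + v * c ∧ b = u + v * d := by
  obtain ⟨c, hc, rfl⟩ := h.left_mem
  obtain ⟨d, hd, rfl⟩ := h.right_mem
  refine ⟨c, d, ⟨hc, hd, ?_, fun z hz => ?_⟩, rfl, rfl⟩
  · exact lt_of_mul_lt_mul_left (lt_of_add_lt_add_left h.lt) hv.le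
  · exact (h.le_or_le _ ⟨z, hz, rfl⟩).imp
      (fun h => le_of_mul_le_mul_left (le_of_add_le_add_left h) hv)
      (fun h => le_of_mul_le_mul_left (le_of_add_le_add_left h) hv)

theorem Thick.image_affine {M u v : ℝ} {K : Set ℝ} (h : Thick M K) (hv : 0 < v) :
    Thick M ((fun z => u + v * z) '' K) := by
  refine ⟨fun a b c d hab hcd hbc => ?_, fun a b hab => ?_, fun a b hab => ?_⟩
  · obtain ⟨a, b, h2, rfl, rfl⟩ := hab.of_image_affine hv
    obtain ⟨c, d, h3, rfl, rfl⟩ := hcd.of_image_affine hv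
    have := mul_le_mul_of_nonneg_left
      (h.pair _ _ _ _ h2 h3 (le_of_mul_le_mul_left (le_of_add_le_add_left hbc) hv)) hv.le
    rw [add_sub_add_left_eq_sub, add_sub_add_left_eq_sub, add_sub_add_left_eq_sub,
      ← mul_sub, ← mul_sub, ← mul_sub, ← mul_min_of_nonneg _ _ hv.le]
    linarith
  · obtain ⟨a, b, h2, rfl, rfl⟩ := hab.of_image_affine hv
    obtain ⟨z, hz, h1⟩ := h.left _ _ h2
    exact ⟨_, ⟨z, hz, rfl⟩, by linarith [mul_le_mul_of_nonneg_left h1 hv.le]⟩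
  · obtain ⟨a, b, h2, rfl, rfl⟩ := hab.of_image_affine hv
    obtain ⟨z, hz, h1⟩ := h.right _ _ h2
    exact ⟨_, ⟨z, hz, rfl⟩, by linarith [mul_le_mul_of_nonneg_left h1 hv.le]⟩

theorem IsCantorSet.image_affine {u v : ℝ} {K : Set ℝ} (h : IsCantorSet K) (hv : v ≠ 0) :
    IsCantorSet ((fun z => u + v * z) '' K) := by
  obtain ⟨h1, h2, h3, h4⟩ := isCantorSet_iff.1 h
  refine isCantorSet_iff.2 ⟨h1.image _, h2.image (by fun_prop), ?_, ?_⟩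
  · have := ((Homeomorph.mulLeft₀ v hv).trans (Homeomorph.addLeft u)).image_interior K
    rw [h3, Set.image_empty] at this
    exact this.symm
  · rintro _ ⟨x, hx, rfl⟩ ε hε
    obtain ⟨y, hy, hne, hd⟩ := h4 x hx (ε / |v|) (div_pos hε (abs_pos.2 hv))
    refine ⟨_, ⟨y, hy, rfl⟩, fun h => hne (mul_left_cancel₀ hv (add_left_cancel h)), ?_⟩
    rw [lt_div_iff₀ (abs_pos.2 hv)] at hd
    rw [add_sub_add_left_eq_sub, ← mul_sub, abs_mul]
    linarith

theorem IsCantorSet.union {A B : Set ℝ} (hA : IsCantorSet A) (hB : IsCantorSet B) :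
    IsCantorSet (A ∪ B) := by
  obtain ⟨h1, h2, h3, h4⟩ := isCantorSet_iff.1 hA
  obtain ⟨h1', h2', h3', h4'⟩ := isCantorSet_iff.1 hB
  refine isCantorSet_iff.2 ⟨h1.inl, h2.union h2', ?_, ?_⟩
  · rw [interior_union_isClosed_of_interior_empty h2.isClosed h3', h3]
  · rintro x (hx | hx) ε hε
    · obtain ⟨y, hy, h⟩ := h4 x hx ε hε
      exact ⟨y, Or.inl hy, h⟩
    · obtain ⟨y, hy, h⟩ := h4' x hx ε hε
      exact ⟨y, Or.inr hy, h⟩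

theorem BddGap.cases_union {A B : Set ℝ} {u v a b : ℝ} (hu : IsGreatest A u) (hv : IsLeast B v)
    (huv : u ≤ v) (h : BddGap (A ∪ B) a b) :
    (BddGap A a b ∧ b ≤ u) ∨ (BddGap B a b ∧ v ≤ a) ∨ (a = u ∧ b = v) := by
  have hlt := h.lt
  rcases h.left_mem with ha | ha
  · rcases h.right_mem with hb | hb
    · exact Or.inl ⟨⟨ha, hb, hlt, fun z hz => h.le_or_le z (Or.inl hz)⟩, hu.2 hb⟩
    · have h1 := hu.2 ha
      have h2 := hv.2 hb
      rcases h.le_or_le u (Or.inl hu.1) with h3 | h3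
      · have hau : a = u := le_antisymm h1 h3
        rcases h.le_or_le v (Or.inr hv.1) with h4 | h4
        · have : a = v := by linarith
          exact Or.inr (Or.inl ⟨⟨this ▸ hv.1, hb, hlt, fun z hz => h.le_or_le z (Or.inr hz)⟩,
            this.ge⟩)
        · exact Or.inr (Or.inr ⟨hau, le_antisymm h4 h2⟩)
      · have : b = u := by linarith
        exact Or.inl ⟨⟨ha, this ▸ hu.1, hlt, fun z hz => h.le_or_le z (Or.inl hz)⟩, h3⟩
  · rcases h.right_mem with hb | hb
    · linarith [hv.2 ha, hu.2 hb]
    · exact Or.inr (Or.inl ⟨⟨ha, hb, hlt, fun z hz => h.le_or_le z (Or.inr hz)⟩, hv.2 ha⟩)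

/-- Gaps in different pieces are separated by the part of one piece reaching to its end, so only the
new gap `(u, v)` needs hypotheses. The case `u = v` is allowed, for gluing `-e C` and `C` at `0`. -/
theorem Thick.union {M u v : ℝ} {A B : Set ℝ} (hM : 0 ≤ M) (hA : Thick M A) (hB : Thick M B)
    (hu : IsGreatest A u) (hv : IsLeast B v) (huv : u ≤ v) (hl : ∃ z ∈ A, M * (v - u) ≤ u - z)
    (hr : ∃ z ∈ B, M * (v - u) ≤ z - v) : Thick M (A ∪ B) := by
  have hA' : ∀ a b, BddGap A a b → M * (b - a) ≤ u - b := fun a b h => by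
    obtain ⟨z, hz, h1⟩ := hA.right a b h
    linarith [hu.2 hz]
  have hB' : ∀ a b, BddGap B a b → M * (b - a) ≤ a - v := fun a b h => by
    obtain ⟨z, hz, h1⟩ := hB.left a b h
    linarith [hv.2 hz]
  refine ⟨fun a b c d hab hcd hbc => ?_, fun a b hab => ?_, fun a b hab => ?_⟩
  · have h1 := mul_le_mul_of_nonneg_left (min_le_left (b - a) (d - c)) hM
    have h2 := mul_le_mul_of_nonneg_left (min_le_right (b - a) (d - c)) hM
    have hab0 := hab.lt
    have hcd0 := hcd.lt
    rcases hab.cases_union hu hv huv with ⟨hab, hb⟩ | ⟨hab, ha⟩ | ⟨rfl, rfl⟩ <;>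
      rcases hcd.cases_union hu hv huv with ⟨hcd, hd⟩ | ⟨hcd, hc⟩ | ⟨rfl, rfl⟩
    · exact hA.pair _ _ _ _ hab hcd hbc
    · linarith [hA' _ _ hab]
    · linarith [hA' _ _ hab]
    · linarith
    · exact hB.pair _ _ _ _ hab hcd hbc
    · linarith
    · linarith
    · linarith [hB' _ _ hcd]
    · linarith
  · rcases hab.cases_union hu hv huv with ⟨hab, hb⟩ | ⟨hab, ha⟩ | ⟨rfl, rfl⟩
    · obtain ⟨z, hz, h⟩ := hA.left _ _ hab
      exact ⟨z, Or.inl hz, h⟩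
    · obtain ⟨z, hz, h⟩ := hB.left _ _ hab
      exact ⟨z, Or.inr hz, h⟩
    · obtain ⟨z, hz, h⟩ := hl
      exact ⟨z, Or.inl hz, h⟩
  · rcases hab.cases_union hu hv huv with ⟨hab, hb⟩ | ⟨hab, ha⟩ | ⟨rfl, rfl⟩
    · obtain ⟨z, hz, h⟩ := hA.right _ _ hab
      exact ⟨z, Or.inl hz, h⟩
    · obtain ⟨z, hz, h⟩ := hB.right _ _ hab
      exact ⟨z, Or.inr hz, h⟩
    · obtain ⟨z, hz, h⟩ := hr
      exact ⟨z, Or.inr hz, h⟩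

/-! ### Sharpness of the condition -/

/-- The union of the copies `-e C`, `C` and `u + v C` of `C`. -/
def threeCopies (C : Set ℝ) (e u v : ℝ) : Set ℝ :=
  ((fun z => 0 + -e * z) '' C ∪ C) ∪ (fun z => u + v * z) '' C

theorem image_neg_mul_eq (C : Set ℝ) (e : ℝ) :
    (fun z => 0 + -e * z) '' C = -((fun z => 0 + e * z) '' C) := by
  rw [← Set.image_neg_eq_neg, Set.image_image]
  simp

theorem IsMiddleCantor.threeCopies_spec {ρ M X e : ℝ} {C : Set ℝ} (hC : IsMiddleCantor ρ C)
    (h0 : 0 < ρ) (h1 : ρ < 1 / 2) (hM : 0 < M) (hMρ : M * (1 - 2 * ρ) ≤ ρ) (hX : 0 < X)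
    (he : 0 < e) (heX : M * X - 1 ≤ e) :
    IsZeroCantorSet (threeCopies C e (1 + X) (M * X)) ∧
      thickness (threeCopies C e (1 + X) (M * X)) = M := by
  have hMX := mul_pos hM hX
  have hCan := hC.isCantorSet h0 h1
  have hT := hC.thick h0 h1 hM.le hMρ
  have hK : IsCantorSet (threeCopies C e (1 + X) (M * X)) :=
    ((hCan.image_affine (neg_ne_zero.2 he.ne')).union hCan).union (hCan.image_affine hMX.ne')
  have hle : ∀ z ∈ C, 0 + -e * z ≤ 0 := fun z hz => by
    linarith [mul_nonneg he.le (hC.subset_Icc hz).1]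
  have hpos : ∀ n : ℕ, ρ ^ n ∈ C := fun n => by
    simpa using hC.pow_mul_mem hC.one_mem n
  have hmemC : ∀ z ∈ C, z ∈ threeCopies C e (1 + X) (M * X) := fun z hz => Or.inl (Or.inr hz)
  have hmemN : ∀ z ∈ C, -(e * z) ∈ threeCopies C e (1 + X) (M * X) := fun z hz =>
    Or.inl (Or.inl ⟨z, hz, by ring⟩)
  have hnegpos : ∀ x ∈ negPart (threeCopies C e (1 + X) (M * X)), 0 < x := fun x hx => by
    have : -x < 0 := hx.2
    linarith
  have hinf : ∀ s : Set ℝ, (∀ x ∈ s, 0 < x) → (∃ c > 0, ∀ n : ℕ, c * ρ ^ n ∈ s) →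
      s.Nonempty ∧ sInf s = 0 := by
    rintro s hs ⟨c, hc, hcs⟩
    have hne : s.Nonempty := ⟨_, hcs 0⟩
    refine ⟨hne, le_antisymm (le_of_forall_pos_lt_add fun ε hε => ?_)
      (le_csInf hne fun x hx => (hs x hx).le)⟩
    obtain ⟨n, hn⟩ := exists_pow_lt_of_lt_one (div_pos hε hc) (by linarith : ρ < 1)
    rw [lt_div_iff₀ hc] at hn
    have := csInf_le ⟨0, fun x hx => (hs x hx).le⟩ (hcs n)
    linarith
  obtain ⟨p1, p2⟩ := hinf (posPart (threeCopies C e (1 + X) (M * X))) (fun x hx => hx.2)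
    ⟨1, one_pos, fun n => ⟨hmemC _ (by simpa using hpos n), by
      have : 0 < 1 * ρ ^ n := by positivity
      exact this⟩⟩
  obtain ⟨n1, n2⟩ := hinf (negPart (threeCopies C e (1 + X) (M * X))) hnegpos
    ⟨e, he, fun n => ⟨hmemN _ (hpos n), by
      have : -(e * ρ ^ n) < 0 := by linarith [mul_pos he (pow_pos h0 n)]
      exact this⟩⟩
  refine ⟨⟨hK, p1, n1, p2, n2⟩, ?_⟩
  have hg0 : IsGreatest ((fun z => 0 + -e * z) '' C) 0 :=
    ⟨⟨0, hC.zero_mem, by simp⟩, by rintro _ ⟨z, hz, rfl⟩; exact hle z hz⟩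
  have hl0 : IsLeast C 0 := ⟨hC.zero_mem, fun z hz => (hC.subset_Icc hz).1⟩
  have hg1 : IsGreatest ((fun z => 0 + -e * z) '' C ∪ C) 1 := by
    refine ⟨Or.inr hC.one_mem, ?_⟩
    rintro z (⟨z, hz, rfl⟩ | hz)
    · exact (hle z hz).trans zero_le_one
    · exact (hC.subset_Icc hz).2
  have hl1 : IsLeast ((fun z => 1 + X + M * X * z) '' C) (1 + X) := by
    refine ⟨⟨0, hC.zero_mem, by simp⟩, ?_⟩
    rintro _ ⟨z, hz, rfl⟩
    have := mul_nonneg hMX.le (hC.subset_Icc hz).1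
    linarith
  have hg2 : IsGreatest (threeCopies C e (1 + X) (M * X)) (1 + X + M * X) := by
    refine ⟨Or.inr ⟨1, hC.one_mem, by simp⟩, ?_⟩
    rintro z (hz | ⟨z, hz, rfl⟩)
    · linarith [hg1.2 hz]
    · have := mul_le_mul_of_nonneg_left (hC.subset_Icc hz).2 hMX.le
      linarith
  have hgap : BddGap (threeCopies C e (1 + X) (M * X)) 1 (1 + X) :=
    ⟨Or.inl hg1.1, Or.inr hl1.1, by linarith, fun z hz => hz.imp (fun h => hg1.2 h)
      (fun h => hl1.2 h)⟩
  refine le_antisymm ?_ ?_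
  -- The gap `(1, 1 + X)` against the unbounded right gap gives exactly `M * X / X`.
  · refine (thickness_le (mem_thicknessSet_right hgap hg2 (by linarith))).trans_eq ?_
    rw [div_eq_iff (by linarith)]
    ring
  · refine Thick.le_thickness hM hK.compact ?_ hgap
    refine Thick.union hM.le (Thick.union hM.le ?_ hT hg0 hl0 le_rfl ⟨0, hg0.1, by simp⟩
      ⟨0, hl0.1, by simp⟩) (hT.image_affine hMX) hg1 hl1 (by linarith) ?_ ?_
    · rw [image_neg_mul_eq]
      exact (hT.image_affine he).neg
    · exact ⟨-e, Or.inl ⟨1, hC.one_mem, by ring⟩, by linarith⟩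
    · exact ⟨1 + X + M * X, ⟨1, hC.one_mem, by ring⟩, by linarith⟩

theorem IsMiddleCantor.mem_threeCopies {ρ e u v k : ℝ} {C : Set ℝ} (hC : IsMiddleCantor ρ C)
    (he : 0 < e) (hv : 0 < v) (hk : k ∈ threeCopies C e u v) :
    (-e ≤ k ∧ k ≤ 1) ∨ (u ≤ k ∧ k ≤ u + v) := by
  rcases hk with (⟨z, hz, rfl⟩ | hz) | ⟨z, hz, rfl⟩
  · have h := hC.subset_Icc hz
    have := mul_le_mul_of_nonneg_left h.2 he.le
    have := mul_nonneg he.le h.1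
    left
    constructor <;> linarith
  · have h := hC.subset_Icc hz
    exact Or.inl ⟨by linarith [h.1], h.2⟩
  · have h := hC.subset_Icc hz
    have := mul_le_mul_of_nonneg_left h.2 hv.le
    have := mul_nonneg hv.le h.1
    right
    constructor <;> linarith

/-- A product with a factor at most `1` is at most `s`: `hef` controls two negative factors. The far
copies times `C` fill `[0, s]`, times the longer negative copy they fill the negative part, and
times each other they fill the upper interval. -/
theorem threeCopies_mul_threeCopies {C : Set ℝ} {ρ s e f x v y w : ℝ} (hC : IsMiddleCantor ρ C)
    (he : 0 < e) (hf : 0 < f) (hx : 1 < x) (hy : 1 < y) (hv : 0 < v) (hw : 0 < w)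
    (hxs : x + v = s) (hys : y + w = s) (hef : e * f ≤ s)
    (hCx : ∀ t, 0 ≤ t → t ≤ s → ∃ a ∈ C, ∃ b ∈ C, a * (x + v * b) = t)
    (hCy : ∀ t, 0 ≤ t → t ≤ s → ∃ a ∈ C, ∃ b ∈ C, a * (y + w * b) = t)
    (hxy : ∀ t, x * y ≤ t → t ≤ s * s → ∃ a ∈ C, ∃ b ∈ C, (x + v * a) * (y + w * b) = t) :
    threeCopies C e x v * threeCopies C f y w =
      Set.Icc (-(max e f * s)) s ∪ Set.Icc (x * y) (s * s) := by
  have hs : 1 < s := by linarith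
  have hme := le_max_left e f
  have hmf := le_max_right e f
  have hm : max e f ≤ max e f * s := le_mul_of_one_le_right (he.le.trans hme) hs.le
  have hes : e * s ≤ max e f * s := mul_le_mul_of_nonneg_right hme (by linarith)
  have hfs : f * s ≤ max e f * s := mul_le_mul_of_nonneg_right hmf (by linarith)
  apply Set.Subset.antisymm
  · rintro _ ⟨k, hk, l, hl, rfl⟩
    dsimp only
    rcases hC.mem_threeCopies he hv hk with ⟨k1, k2⟩ | ⟨k1, k2⟩ <;>
      rcases hC.mem_threeCopies hf hw hl with ⟨l1, l2⟩ | ⟨l1, l2⟩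
    · left
      rcases le_total 0 k with hk0 | hk0
      · have h1 := mul_le_mul_of_nonneg_left l1 hk0
        have h2 := mul_le_mul_of_nonneg_left l2 hk0
        have h3 := mul_le_mul_of_nonneg_right k2 hf.le
        constructor <;> linarith
      · have h1 := mul_le_mul_of_nonpos_left l1 hk0
        have h2 := mul_le_mul_of_nonpos_left l2 hk0
        have h3 := mul_le_mul_of_nonneg_right k1 hf.le
        constructor <;> linarith
    · left
      have hl0 : 0 ≤ l := by linarith
      have h1 := mul_le_mul_of_nonneg_right k1 hl0
      have h2 := mul_le_mul_of_nonneg_right k2 hl0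
      have h3 := mul_le_mul_of_nonneg_left l2 he.le
      rw [hys] at h3
      constructor <;> linarith
    · left
      have hk0 : 0 ≤ k := by linarith
      have h1 := mul_le_mul_of_nonneg_left l1 hk0
      have h2 := mul_le_mul_of_nonneg_left l2 hk0
      have h3 := mul_le_mul_of_nonneg_left k2 hf.le
      rw [hxs] at h3
      constructor <;> linarith
    · right
      refine ⟨mul_le_mul k1 l1 (by linarith) (by linarith), ?_⟩
      rw [← hxs]
      refine mul_le_mul k2 ?_ (by linarith) (by linarith)
      linarith
  · rintro t (⟨h1, h2⟩ | ⟨h1, h2⟩)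
    · rcases le_total 0 t with ht | ht
      · obtain ⟨a, ha, b, hb, h⟩ := hCy t ht h2
        exact ⟨a, Or.inl (Or.inr ha), _, Or.inr ⟨b, hb, rfl⟩, h⟩
      · rcases le_total f e with hfe | hfe
        · rw [max_eq_left hfe] at h1
          obtain ⟨a, ha, b, hb, h⟩ := hCy (-t / e) (div_nonneg (by linarith) he.le)
            ((div_le_iff₀ he).2 (by linarith))
          refine ⟨_, Or.inl (Or.inl ⟨a, ha, rfl⟩), _, Or.inr ⟨b, hb, rfl⟩, ?_⟩
          rw [eq_div_iff he.ne'] at h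
          dsimp only
          linarith
        · rw [max_eq_right hfe] at h1
          obtain ⟨a, ha, b, hb, h⟩ := hCx (-t / f) (div_nonneg (by linarith) hf.le)
            ((div_le_iff₀ hf).2 (by linarith))
          refine ⟨_, Or.inr ⟨b, hb, rfl⟩, _, Or.inl (Or.inl ⟨a, ha, rfl⟩), ?_⟩
          rw [eq_div_iff hf.ne'] at h
          dsimp only
          linarith
    · obtain ⟨a, ha, b, hb, h⟩ := hxy t h1 h2
      exact ⟨_, Or.inr ⟨a, ha, rfl⟩, _, Or.inr ⟨b, hb, rfl⟩, h⟩

/-- If one bound is not positive, its variable can be as small as the reciprocal of the other. -/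
theorem exists_pos_ge_mul_le {e f s : ℝ} (hs : 1 ≤ s) (h : 0 < e → 0 < f → e * f ≤ s) :
    ∃ e' f', 0 < e' ∧ 0 < f' ∧ e ≤ e' ∧ f ≤ f' ∧ e' * f' ≤ s := by
  have small : ∀ {g : ℝ}, max g 1 * (1 / max g 1) ≤ s := fun {g} => by
    rw [mul_one_div_cancel (by positivity)]
    exact hs
  rcases lt_or_ge 0 e with he | he
  · rcases lt_or_ge 0 f with hf | hf
    · exact ⟨e, f, he, hf, le_rfl, le_rfl, h he hf⟩
    · exact ⟨max e 1, 1 / max e 1, by positivity, by positivity, le_max_left _ _,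
        hf.trans (by positivity), small⟩
  · exact ⟨1 / max f 1, max f 1, by positivity, by positivity, he.trans (by positivity),
      le_max_left _ _, by rw [mul_comm]; exact small⟩

theorem exists_scale {M N : ℝ} (hM : 0 < M) (hN : 0 < N)
    (h : (M * N - 1) ^ 2 < 2 * (M + 1) * (N + 1)) :
    ∃ S > 0, M * N - 1 < S ∧ ∃ e f, 0 < e ∧ 0 < f ∧ M * (S / (M + 1)) - 1 ≤ e ∧
      N * (S / (N + 1)) - 1 ≤ f ∧ e * f ≤ 1 + S := by
  rcases lt_or_ge (M * N - 1) 1 with hD | hD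
  · refine ⟨1, one_pos, hD, 1, 1, one_pos, one_pos, ?_, ?_, by norm_num⟩
    · have : M * (1 / (M + 1)) ≤ 1 := by
        rw [mul_one_div, div_le_one (by linarith)]
        linarith
      linarith
    · have : N * (1 / (N + 1)) ≤ 1 := by
        rw [mul_one_div, div_le_one (by linarith)]
        linarith
      linarith
  -- At the critical value `S = M * N - 1` the inequality is strict by exactly the hypothesis, so it
  -- survives a small increase of `S`.
  · have hF : (M * ((M * N - 1) / (M + 1)) - 1) * (N * ((M * N - 1) / (N + 1)) - 1) <
        1 + (M * N - 1) := by
      have : (M * ((M * N - 1) / (M + 1)) - 1) * (N * ((M * N - 1) / (N + 1)) - 1) =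
          1 + (M * N - 1) - (M * N - 1) * (2 * (M + 1) * (N + 1) - (M * N - 1) ^ 2) /
            ((M + 1) * (N + 1)) := by
        field_simp
        ring
      rw [this]
      have : 0 < (M * N - 1) * (2 * (M + 1) * (N + 1) - (M * N - 1) ^ 2) /
            ((M + 1) * (N + 1)) :=
        div_pos (mul_pos (by linarith) (by linarith)) (by positivity)
      linarith
    have hev : ∀ᶠ S in nhds (M * N - 1),
        (M * (S / (M + 1)) - 1) * (N * (S / (N + 1)) - 1) < 1 + S :=
      (ContinuousAt.eventually_lt (by fun_prop) (by fun_prop) hF)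
    obtain ⟨S, hS, hS'⟩ := ((hev.filter_mono nhdsWithin_le_nhds).and
      (self_mem_nhdsWithin (s := Set.Ioi (M * N - 1)))).exists
    have hS' : M * N - 1 < S := hS'
    exact ⟨S, by linarith, hS', exists_pos_ge_mul_le (by linarith) fun _ _ => hS.le⟩

/-- All the required inequalities except `ρ < 1 / 2` are strict at `ρ = 1 / 2`, so they hold for `ρ`
slightly smaller. -/
theorem exists_ratio {M N x y v w : ℝ} (hx : 0 < x) (hy : 0 < y) (hv : 0 < v) (hw : 0 < w) :
    ∃ ρ, 0 < ρ ∧ ρ < 1 / 2 ∧ M * (1 - 2 * ρ) ≤ ρ ∧ N * (1 - 2 * ρ) ≤ ρ ∧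
      (ρ * (x + v) * (1 - 2 * ρ) ≤ v * (1 - ρ) ∧ v * (1 - 2 * ρ) ≤ ρ * ρ * x ∧
        (1 - ρ) * x ≤ ρ * (x + v)) ∧
      (ρ * (y + w) * (1 - 2 * ρ) ≤ w * (1 - ρ) ∧ w * (1 - 2 * ρ) ≤ ρ * ρ * y ∧
        (1 - ρ) * y ≤ ρ * (y + w)) ∧
      v * (y + w) * (1 - 2 * ρ) ≤ w * x ∧ w * (x + v) * (1 - 2 * ρ) ≤ ρ * v * y := by
  have hev : ∀ f g : ℝ → ℝ, Continuous f → Continuous g → f (1 / 2) < g (1 / 2) →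
      ∀ᶠ ρ in nhdsWithin (1 / 2) (Set.Iio (1 / 2)), f ρ ≤ g ρ := fun f g hf hg h =>
    ((hf.continuousAt.eventually_lt hg.continuousAt h).filter_mono nhdsWithin_le_nhds).mono
      fun _ h => h.le
  have hlt : ∀ᶠ ρ : ℝ in nhdsWithin (1 / 2) (Set.Iio (1 / 2)), ρ < 1 / 2 := self_mem_nhdsWithin
  have hvy := mul_pos hv hy
  have hwx := mul_pos hw hx
  have H := ((hev (fun _ => 1 / 4) (fun ρ => ρ) (by fun_prop) (by fun_prop) (by norm_num)).and <|
    hlt.and <|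
    (hev (fun ρ => M * (1 - 2 * ρ)) (fun ρ => ρ) (by fun_prop) (by fun_prop) (by norm_num)).and <|
    (hev (fun ρ => N * (1 - 2 * ρ)) (fun ρ => ρ) (by fun_prop) (by fun_prop) (by norm_num)).and <|
    ((hev (fun ρ => ρ * (x + v) * (1 - 2 * ρ)) (fun ρ => v * (1 - ρ)) (by fun_prop)
      (by fun_prop) (by linarith)).and <|
    (hev (fun ρ => v * (1 - 2 * ρ)) (fun ρ => ρ * ρ * x) (by fun_prop)
      (by fun_prop) (by linarith)).and <|
    (hev (fun ρ => (1 - ρ) * x) (fun ρ => ρ * (x + v)) (by fun_prop)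
      (by fun_prop) (by linarith))).and <|
    ((hev (fun ρ => ρ * (y + w) * (1 - 2 * ρ)) (fun ρ => w * (1 - ρ)) (by fun_prop)
      (by fun_prop) (by linarith)).and <|
    (hev (fun ρ => w * (1 - 2 * ρ)) (fun ρ => ρ * ρ * y) (by fun_prop)
      (by fun_prop) (by linarith)).and <|
    (hev (fun ρ => (1 - ρ) * y) (fun ρ => ρ * (y + w)) (by fun_prop)
      (by fun_prop) (by linarith))).and <|
    (hev (fun ρ => v * (y + w) * (1 - 2 * ρ)) (fun _ => w * x) (by fun_prop)
      (by fun_prop) (by linarith)).and <|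
    (hev (fun ρ => w * (x + v) * (1 - 2 * ρ)) (fun ρ => ρ * v * y) (by fun_prop)
      (by fun_prop) (by linarith)))
  obtain ⟨ρ, h1, h2, h⟩ := H.exists
  exact ⟨ρ, by linarith, h2, h⟩

theorem exists_mul_eq_union_Icc {M N : ℝ} (hM : 0 < M) (hN : 0 < N)
    (h : (M * N - 1) ^ 2 < 2 * (M + 1) * (N + 1)) :
    ∃ K L : Set ℝ, IsZeroCantorSet K ∧ IsZeroCantorSet L ∧ thickness K = M ∧ thickness L = N ∧
      ∃ a b c d : ℝ, a < b ∧ b < c ∧ c < d ∧ K * L = Set.Icc a b ∪ Set.Icc c d := by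
  obtain ⟨S, hS0, hS, e, f, he, hf, heX, hfY, hef⟩ := exists_scale hM hN h
  obtain ⟨X, hX⟩ : ∃ X, X = S / (M + 1) := ⟨_, rfl⟩
  obtain ⟨Y, hY⟩ : ∃ Y, Y = S / (N + 1) := ⟨_, rfl⟩
  rw [← hX] at heX
  rw [← hY] at hfY
  have hX0 : 0 < X := hX ▸ by positivity
  have hY0 : 0 < Y := hY ▸ by positivity
  have hXS : X * (M + 1) = S := by rw [hX]; field_simp
  have hYS : Y * (N + 1) = S := by rw [hY]; field_simp
  have hMX := mul_pos hM hX0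
  have hNY := mul_pos hN hY0
  have hxs : (1 + X) + M * X = 1 + S := by linarith
  have hys : (1 + Y) + N * Y = 1 + S := by linarith
  -- Multiplied by `(M + 1) * (N + 1) / S`, this is `M * N - 1 < S`.
  have hgap : 1 + S < (1 + X) * (1 + Y) := by
    have h1 : S * ((M + 1) * (N + 1)) < S * (S + M + 1 + N + 1) :=
      mul_lt_mul_of_pos_left (by linarith) hS0
    have h2 : (X * Y + X + Y) * ((M + 1) * (N + 1)) = S * (S + M + 1 + N + 1) := by
      calc _ = (X * (M + 1)) * (Y * (N + 1)) + (X * (M + 1)) * (N + 1) +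
            (Y * (N + 1)) * (M + 1) := by ring
        _ = _ := by rw [hXS, hYS]; ring
    rw [← h2] at h1
    have := lt_of_mul_lt_mul_right h1 (by positivity)
    linarith
  obtain ⟨ρ, h0, h1, hMρ, hNρ, ⟨x1, x2, x3⟩, ⟨y1, y2, y3⟩, z1, z2⟩ :=
    exists_ratio (M := M) (N := N) (x := 1 + X) (y := 1 + Y) (by linarith) (by linarith) hMX hNY
  obtain ⟨C, hC⟩ := exists_isMiddleCantor h0 (by linarith)
  obtain ⟨k1, k2⟩ := hC.threeCopies_spec h0 h1 hM hMρ hX0 he heX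
  obtain ⟨l1, l2⟩ := hC.threeCopies_spec h0 h1 hN hNρ hY0 hf hfY
  refine ⟨_, _, k1, l1, k2, l2, -(max e f * (1 + S)), 1 + S, (1 + X) * (1 + Y),
    (1 + S) * (1 + S), ?_, hgap, ?_, ?_⟩
  · have : 0 < max e f * (1 + S) := by positivity
    linarith
  · exact mul_lt_mul'' (by linarith) (by linarith) (by linarith) (by linarith)
  · refine threeCopies_mul_threeCopies hC he hf (by linarith) (by linarith) hMX hNY hxs hys hef
      (fun t ht1 ht2 => ?_) (fun t ht1 ht2 => ?_) (fun t ht1 ht2 => ?_)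
    · exact hC.exists_mul_affine_eq h0 h1 (by linarith) hMX x1 x2 x3 ht1 (hxs ▸ ht2)
    · exact hC.exists_mul_affine_eq h0 h1 (by linarith) hNY y1 y2 y3 ht1 (hys ▸ ht2)
    · refine hC.exists_affine_mul_affine_eq h0 h1 (by linarith) hMX (by linarith) hNY z1 z2 ht1 ?_
      rwa [hxs, hys]

end CantorProduct

theorem mainTheorem3 :
    (∀ K L : Set ℝ, CantorProduct.IsZeroCantorSet K → CantorProduct.IsZeroCantorSet L →
      2 * (CantorProduct.thickness K + 1) * (CantorProduct.thickness L + 1)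
        ≤ (CantorProduct.thickness K * CantorProduct.thickness L - 1) ^ 2 →
      ∃ a b : ℝ, a < b ∧ K * L = Set.Icc a b) ∧
    (∀ K L : Set ℝ, CantorProduct.IsZeroCantorSet K → CantorProduct.IsZeroCantorSet L →
      CantorProduct.thickness K = CantorProduct.thickness L →
      1 + Real.sqrt 2 ≤ CantorProduct.thickness K →
      ∃ a b : ℝ, a < b ∧ K * L = Set.Icc a b) ∧
    (∀ M N : ℝ, 0 < M → 0 < N → (M * N - 1) ^ 2 < 2 * (M + 1) * (N + 1) →
      ∃ K L : Set ℝ, CantorProduct.IsZeroCantorSet K ∧ CantorProduct.IsZeroCantorSet L ∧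
        CantorProduct.thickness K = M ∧ CantorProduct.thickness L = N ∧
        ∃ a b c d : ℝ, a < b ∧ b < c ∧ c < d ∧
          K * L = Set.Icc a b ∪ Set.Icc c d) := by
  refine ⟨fun K L hK hL h => hK.exists_mul_eq_Icc hL h, fun K L hK hL hKL h => ?_,
    fun M N hM hN h => CantorProduct.exists_mul_eq_union_Icc hM hN h⟩
  refine hK.exists_mul_eq_Icc hL ?_
  rw [← hKL]
  exact CantorProduct.thickness_condition_of_eq h
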